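/- Let $-\infty\le a<b\le\infty$ and let $p,q,r,s$ be Lebesgue measurable, real-valued functions on $(a,b)$ with $p^{-1},q,r,s\in L^1_{\mathrm{loc}}((a,b);dx)$ and $r>0$, $p\neq 0$ a.e. on $(a,b)$. Let $\mathfrak D_\tau$ be the set of complex-valued $f\in AC_{\mathrm{loc}}((a,b))$ whose first quasi-derivative $f^{[1]}=p\,(f'+sf)$ also lies in $AC_{\mathrm{loc}}((a,b))$, and put $$\tau f=\frac1r\left(-\big(f^{[1]}\big)'+s f^{[1]}+q f\right),\qquad f\in\mathfrak D_\tau .$$ In the Hilbert space $L^2((a,b);r(x)dx)$ let $T_{\max}f=\tau f$ with domain $\{f\in L^2((a,b);r(x)dx)\mid f\in\mathfrak D_\tau,\ \tau f\in L^2((a,b);r(x)dx)\}$, let $T_0$ be the restriction of $T_{\max}$ to the functions in its domain that have compact support in $(a,b)$, and let $T_{\min}=\overline{T_0}$ be the closure of $T_0$. A function lies in $L^2((a,b);r(x)dx)$ near $a$ (resp. near $b$) if it lies in $L^2((a,c);r(x)dx)$ (resp. in $L^2((c,b);r(x)dx)$) for each $c\in(a,b)$. One says that $\tau$ is limit-circle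 (l.c.) at an endpoint if for each $z\in\mathbb C$ all solutions $u\in\mathfrak D_\tau$ of $(\tau-z)u=0$ lie in $L^2((a,b);r(x)dx)$ near that endpoint, and limit-point (l.p.) at an endpoint if for each $z\in\mathbb C$ some solution $u\in\mathfrak D_\tau$ of $(\tau-z)u=0$ does not lie in $L^2((a,b);r(x)dx)$ near that endpoint. Then the following hold. (0) $T_0$ is densely defined and closable, and $T_{\min}$ is symmetric, so that $T_{\min}$ and its deficiency indices $n_\pm(T_{\min})=\dim\big(\operatorname{ran}(T_{\min}\pm \mathrm i)^{\perp}\big)$ are well defined. (i) (Weyl's alternative) At each of the endpoints $a$ and $b$, $\tau$ is either l.c. or l.p., and not both. (ii) The deficiency indices of $T_{\min}$ are equal and given by $$n_+(T_{\min})=n_-(T_{\min})=\begin{cases}0,&\text{if }\tau\text{ is l.c. at neither endpoint},\\ 1,&\text{if }\tau\text{ is l.c. at exactly one endpoint},\\ 2,&\text{if }\tau\text{ is l.c. at both endpoints.}\end{cases}$$ (iii) If $\tau$ is l.p. at both endpoints, then $T_{\min}=T_{\max}$, and this operator is self-adjoint. -/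

import Mathlib

open MeasureTheory Set Filter Topology

noncomputable section

/-- Coefficients of a Sturm--Liouville differential expression
`τ f = (1/r) (-(f^[1])' + s f^[1] + q f)`, `f^[1] = p (f' + s f)`, on a nonempty open interval
`(a, b) ⊆ ℝ`, bounded or not: `p`, `q`, `r`, `s` are real-valued and Lebesgue measurable on
`(a, b)`, `1/p`, `q`, `r`, `s` are locally integrable there, and `r > 0`, `p ≠ 0` a.e. -/
structure SturmLiouville where
  a : EReal
  b : EReal
  p : ℝ → ℝ
  q : ℝ → ℝ
  r : ℝ → ℝ
  s : ℝ → ℝ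
  a_lt_b : a < b
  aemeasurable_p : AEMeasurable p (volume.restrict {x : ℝ | a < x ∧ x < b})
  locInt_inv_p : LocallyIntegrableOn (fun x => (p x)⁻¹) {x : ℝ | a < x ∧ x < b} volume
  locInt_q : LocallyIntegrableOn q {x : ℝ | a < x ∧ x < b} volume
  locInt_r : LocallyIntegrableOn r {x : ℝ | a < x ∧ x < b} volume
  locInt_s : LocallyIntegrableOn s {x : ℝ | a < x ∧ x < b} volume
  r_pos : ∀ᵐ x ∂(volume.restrict {x : ℝ | a < x ∧ x < b}), 0 < r x
  p_ne_zero : ∀ᵐ x ∂(volume.restrict {x : ℝ | a < x ∧ x < b}), p x ≠ 0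

namespace SturmLiouville

variable (τ : SturmLiouville)

/-- The open interval `(a, b)`. -/
def I : Set ℝ := {x : ℝ | τ.a < x ∧ x < τ.b}

/-- The measure `r(x) dx` on `(a, b)`. -/
def μ : Measure ℝ := (volume.restrict τ.I).withDensity (fun x => ENNReal.ofReal (τ.r x))

/-- The Hilbert space `L²((a, b); r(x) dx)`. -/
abbrev H : Type := Lp ℂ 2 τ.μ

/-- `f ∈ AC_loc((a, b))`. -/
def ACLoc (f : ℝ → ℂ) : Prop :=
  ∀ α ∈ τ.I, ∀ β ∈ τ.I, AbsolutelyContinuousOnInterval f α β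

/-- `f ∈ 𝔇_τ` with first quasi-derivative `f₁ = f^[1] = p (f' + s f)`: both `f` and `f₁` are
locally absolutely continuous on `(a, b)`. On `(a, b)` the function `f₁` is determined by `f`, as
the locally absolutely continuous representative of `p (f' + s f)`. -/
structure IsQuasiDeriv (f f₁ : ℝ → ℂ) : Prop where
  ac : τ.ACLoc f
  ac₁ : τ.ACLoc f₁
  eq : f₁ =ᵐ[volume.restrict τ.I] fun x => (τ.p x : ℂ) * (deriv f x + (τ.s x : ℂ) * f x)

/-- The function `τ f`, for `f ∈ 𝔇_τ` with first quasi-derivative `f₁`. -/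
def expr (f f₁ : ℝ → ℂ) (x : ℝ) : ℂ :=
  (1 / (τ.r x : ℂ)) * (-deriv f₁ x + (τ.s x : ℂ) * f₁ x + (τ.q x : ℂ) * f x)

/-- `u ∈ 𝔇_τ` is a solution of `(τ - z) u = 0` on `(a, b)`. -/
def IsSolution (z : ℂ) (u : ℝ → ℂ) : Prop :=
  ∃ u₁ : ℝ → ℂ, τ.IsQuasiDeriv u u₁ ∧
    ∀ᵐ x ∂(volume.restrict τ.I), τ.expr u u₁ x - z * u x = 0

/-- `f` lies in `L²((a, b); r(x) dx)` near `a`. -/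
def L2NearA (f : ℝ → ℂ) : Prop :=
  ∀ c ∈ τ.I, MemLp f 2 (τ.μ.restrict (Iio c))

/-- `f` lies in `L²((a, b); r(x) dx)` near `b`. -/
def L2NearB (f : ℝ → ℂ) : Prop :=
  ∀ c ∈ τ.I, MemLp f 2 (τ.μ.restrict (Ioi c))

/-- `τ` is in the limit-circle case at `a`. -/
def LimitCircleA : Prop := ∀ z : ℂ, ∀ u : ℝ → ℂ, τ.IsSolution z u → τ.L2NearA u

/-- `τ` is in the limit-point case at `a`. -/
def LimitPointA : Prop := ∀ z : ℂ, ∃ u : ℝ → ℂ, τ.IsSolution z u ∧ ¬ τ.L2NearA u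

/-- `τ` is in the limit-circle case at `b`. -/
def LimitCircleB : Prop := ∀ z : ℂ, ∀ u : ℝ → ℂ, τ.IsSolution z u → τ.L2NearB u

/-- `τ` is in the limit-point case at `b`. -/
def LimitPointB : Prop := ∀ z : ℂ, ∃ u : ℝ → ℂ, τ.IsSolution z u ∧ ¬ τ.L2NearB u

/-! ### Facts needed to see that the maximal operator is a well-defined linear operator -/

lemma isOpen_I : IsOpen τ.I :=
  (isOpen_lt continuous_const continuous_coe_real_ereal).inter
    (isOpen_lt continuous_coe_real_ereal continuous_const)

lemma measurableSet_I : MeasurableSet τ.I := τ.isOpen_I.measurableSet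

lemma ordConnected_I : OrdConnected τ.I :=
  ⟨fun _ hx _ hy _ hz => ⟨hx.1.trans_le (EReal.coe_le_coe_iff.2 hz.1),
    (EReal.coe_le_coe_iff.2 hz.2).trans_lt hy.2⟩⟩

lemma ae_μ_iff {P : ℝ → Prop} : (∀ᵐ x ∂τ.μ, P x) ↔ ∀ᵐ x ∂(volume.restrict τ.I), P x := by
  have hr : AEMeasurable (fun x => ENNReal.ofReal (τ.r x)) (volume.restrict τ.I) :=
    (τ.locInt_r.aestronglyMeasurable).aemeasurable.ennreal_ofReal
  rw [μ, ae_withDensity_iff' hr]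
  constructor
  · intro h
    filter_upwards [h, (show ∀ᵐ x ∂(volume.restrict τ.I), 0 < τ.r x from τ.r_pos)] with x hx hx'
    exact hx (by simpa using hx')
  · intro h
    filter_upwards [h] with x hx _ using hx

variable {τ}

lemma ACLoc.continuousOn {f : ℝ → ℂ} (hf : τ.ACLoc f) : ContinuousOn f τ.I := by
  intro x hx
  obtain ⟨ε, hε, hb⟩ := Metric.isOpen_iff.1 τ.isOpen_I x hx
  have hl : x - ε / 2 ∈ τ.I := hb (by simp [abs_of_pos hε]; linarith)
  have hr : x + ε / 2 ∈ τ.I := hb (by simp [abs_of_pos hε]; linarith)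
  have h := (hf _ hl _ hr).continuousOn
  rw [uIcc_of_le (by linarith)] at h
  exact (h.continuousAt (Icc_mem_nhds (by linarith) (by linarith))).continuousWithinAt

lemma ACLoc.ae_differentiableAt {f : ℝ → ℂ} (hf : τ.ACLoc f) :
    ∀ᵐ x ∂(volume.restrict τ.I), DifferentiableAt ℝ f x := by
  have hbv : LocallyBoundedVariationOn f τ.I := fun x y hx hy => by
    refine ((hf x hx y hy).boundedVariationOn).mono ?_
    exact inter_subset_right.trans Icc_subset_uIcc
  rw [ae_restrict_iff' τ.measurableSet_I]
  filter_upwards [hbv.ae_differentiableWithinAt_of_mem] with x hx hxI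
  exact (hx hxI).differentiableAt (τ.isOpen_I.mem_nhds hxI)

lemma eqOn_zero_of_ae {f : ℝ → ℂ} (hf : τ.ACLoc f)
    (h : ∀ᵐ x ∂(volume.restrict τ.I), f x = 0) : EqOn f 0 τ.I :=
  Measure.eqOn_open_of_ae_eq (μ := volume) h τ.isOpen_I hf.continuousOn continuousOn_const

lemma IsQuasiDeriv.add {f f₁ g g₁ : ℝ → ℂ} (hf : τ.IsQuasiDeriv f f₁) (hg : τ.IsQuasiDeriv g g₁) :
    τ.IsQuasiDeriv (f + g) (f₁ + g₁) where
  ac := fun α hα β hβ => (hf.ac α hα β hβ).add (hg.ac α hα β hβ)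
  ac₁ := fun α hα β hβ => (hf.ac₁ α hα β hβ).add (hg.ac₁ α hα β hβ)
  eq := by
    filter_upwards [hf.eq, hg.eq, hf.ac.ae_differentiableAt, hg.ac.ae_differentiableAt]
      with x h1 h2 h3 h4
    rw [deriv_add h3 h4]
    simp only [Pi.add_apply, h1, h2]
    ring

lemma IsQuasiDeriv.smul {f f₁ : ℝ → ℂ} (c : ℂ) (hf : τ.IsQuasiDeriv f f₁) :
    τ.IsQuasiDeriv (c • f) (c • f₁) where
  ac := fun α hα β hβ => (hf.ac α hα β hβ).const_smul c
  ac₁ := fun α hα β hβ => (hf.ac₁ α hα β hβ).const_smul c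
  eq := by
    filter_upwards [hf.eq] with x h1
    rw [deriv_const_smul_field]
    simp only [Pi.smul_apply, h1, smul_eq_mul]
    ring

lemma IsQuasiDeriv.zero : τ.IsQuasiDeriv 0 0 where
  ac := fun α _ β _ =>
    (LipschitzWith.const (0 : ℂ)).lipschitzOnWith.absolutelyContinuousOnInterval
  ac₁ := fun α _ β _ =>
    (LipschitzWith.const (0 : ℂ)).lipschitzOnWith.absolutelyContinuousOnInterval
  eq := Eventually.of_forall fun x => by simp

variable (τ)

/-- The graph of the maximal operator: all pairs `(F, G)` in `L²((a, b); r(x) dx)` such that `F`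
has a representative `f ∈ 𝔇_τ` with `τ f = G`. -/
def maxGraph : Submodule ℂ (τ.H × τ.H) where
  carrier := {F | ∃ f f₁ : ℝ → ℂ, τ.IsQuasiDeriv f f₁ ∧
    (F.1 : ℝ → ℂ) =ᵐ[τ.μ] f ∧ (F.2 : ℝ → ℂ) =ᵐ[τ.μ] τ.expr f f₁}
  zero_mem' := by
    refine ⟨0, 0, IsQuasiDeriv.zero, Lp.coeFn_zero .., ?_⟩
    refine (Lp.coeFn_zero ..).trans (Eventually.of_forall fun x => ?_)
    simp [expr]
  add_mem' := by
    rintro F G ⟨f, f₁, hf, hf1, hf2⟩ ⟨g, g₁, hg, hg1, hg2⟩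
    refine ⟨f + g, f₁ + g₁, hf.add hg, (Lp.coeFn_add ..).trans (hf1.add hg1), ?_⟩
    refine (Lp.coeFn_add ..).trans ?_
    filter_upwards [hf2, hg2, τ.ae_μ_iff.2 hf.ac₁.ae_differentiableAt,
      τ.ae_μ_iff.2 hg.ac₁.ae_differentiableAt] with x h1 h2 h3 h4
    simp only [Pi.add_apply, h1, h2, expr]
    rw [deriv_add h3 h4]
    ring
  smul_mem' := by
    rintro c F ⟨f, f₁, hf, hf1, hf2⟩
    refine ⟨c • f, c • f₁, hf.smul c, (Lp.coeFn_smul ..).trans (hf1.const_smul c), ?_⟩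
    refine (Lp.coeFn_smul ..).trans ?_
    filter_upwards [hf2] with x h1
    simp only [Pi.smul_apply, h1, expr]
    rw [deriv_const_smul_field]
    simp only [smul_eq_mul]
    ring

/-- `maxGraph` is the graph of an operator: it is single-valued. -/
lemma maxGraph_fst_eq_zero (F : τ.H × τ.H) (hF : F ∈ τ.maxGraph) (h0 : F.1 = 0) : F.2 = 0 := by
  obtain ⟨f, f₁, hf, h1, h2⟩ := hF
  have hf0 : EqOn f 0 τ.I := by
    refine eqOn_zero_of_ae hf.ac (τ.ae_μ_iff.1 ?_)
    rw [h0] at h1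
    filter_upwards [h1, Lp.coeFn_zero ℂ 2 τ.μ] with x hx hx'
    rw [← hx, hx', Pi.zero_apply]
  have hd : ∀ {g : ℝ → ℂ}, EqOn g 0 τ.I → ∀ x ∈ τ.I, deriv g x = 0 := fun hg x hx => by
    rw [(hg.eventuallyEq_of_mem (τ.isOpen_I.mem_nhds hx)).deriv_eq]
    simp
  have hf10 : EqOn f₁ 0 τ.I := by
    refine eqOn_zero_of_ae hf.ac₁ ?_
    filter_upwards [hf.eq, ae_restrict_mem τ.measurableSet_I] with x hx hxI
    rw [hx, hd hf0 x hxI, hf0 hxI]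
    simp
  refine Lp.ext (h2.trans (EventuallyEq.trans ?_ (Lp.coeFn_zero ℂ 2 τ.μ).symm))
  refine τ.ae_μ_iff.2 ?_
  filter_upwards [ae_restrict_mem τ.measurableSet_I] with x hxI
  simp [expr, hd hf10 x hxI, hf0 hxI, hf10 hxI]

/-! ### The operators -/

/-- The maximal operator `T_max`. -/
def Tmax : τ.H →ₗ.[ℂ] τ.H := τ.maxGraph.toLinearPMap

/-- The graph of `T_max` is as prescribed. -/
lemma Tmax_graph : τ.Tmax.graph = τ.maxGraph :=
  Submodule.toLinearPMap_graph_eq _ (fun F hF => τ.maxGraph_fst_eq_zero F hF)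

/-- The elements of `L²((a, b); r(x) dx)` with compact support in `(a, b)`. -/
def compactlySupported : Submodule ℂ τ.H where
  carrier := {F | ∃ K : Set ℝ, IsCompact K ∧ K ⊆ τ.I ∧ ∀ᵐ x ∂τ.μ, x ∉ K → F x = 0}
  zero_mem' := ⟨∅, isCompact_empty, empty_subset _, by
    filter_upwards [Lp.coeFn_zero ℂ 2 τ.μ] with x hx _
    rw [hx, Pi.zero_apply]⟩
  add_mem' := by
    rintro F G ⟨K, hK, hKI, hF⟩ ⟨L, hL, hLI, hG⟩
    refine ⟨K ∪ L, hK.union hL, union_subset hKI hLI, ?_⟩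
    filter_upwards [hF, hG, Lp.coeFn_add F G] with x h1 h2 h3 hx
    rw [h3, Pi.add_apply, h1 (fun h => hx (Or.inl h)), h2 (fun h => hx (Or.inr h)), add_zero]
  smul_mem' := by
    rintro c F ⟨K, hK, hKI, hF⟩
    refine ⟨K, hK, hKI, ?_⟩
    filter_upwards [hF, Lp.coeFn_smul c F] with x h1 h2 hx
    rw [h2, Pi.smul_apply, h1 hx, smul_zero]

/-- The operator `T₀`: the restriction of `T_max` to functions with compact support. -/
def T0 : τ.H →ₗ.[ℂ] τ.H := τ.Tmax.domRestrict τ.compactlySupported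

/-- The minimal operator `T_min`: the closure of `T₀`. -/
def Tmin : τ.H →ₗ.[ℂ] τ.H := τ.T0.closure

end SturmLiouville

/-- `dim (ran (T - z))^⊥`. The deficiency indices of a densely defined symmetric operator `T` are
its values at `z = i` and `z = -i`. -/
def defectNumber {E : Type*} [NormedAddCommGroup E] [InnerProductSpace ℂ E]
    (T : E →ₗ.[ℂ] E) (z : ℂ) : Cardinal :=
  Module.rank ℂ ↥(LinearMap.range (T.toFun - z • T.domain.subtype))ᗮ

end

/-! ### Absolutely continuous functions -/

theorem IntervalIntegrable.complex_ofReal {f : ℝ → ℝ} {a b : ℝ}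
    (h : IntervalIntegrable f volume a b) :
    IntervalIntegrable (fun x => (f x : ℂ)) volume a b :=
  ⟨Integrable.ofReal h.1, Integrable.ofReal h.2⟩

namespace AbsolutelyContinuousOnInterval

theorem of_dist_le {X Y : Type*} [PseudoMetricSpace X] [PseudoMetricSpace Y]
    {f : ℝ → X} {g : ℝ → Y} {a b K : ℝ} (hg : AbsolutelyContinuousOnInterval g a b)
    (h : ∀ x ∈ uIcc a b, ∀ y ∈ uIcc a b, dist (f x) (f y) ≤ K * dist (g x) (g y)) :
    AbsolutelyContinuousOnInterval f a b := by
  have h' : ∀ x ∈ uIcc a b, ∀ y ∈ uIcc a b,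
      dist (f x) (f y) ≤ (|K| + 1) * dist (g x) (g y) := fun x hx y hy =>
    (h x hx y hy).trans (mul_le_mul_of_nonneg_right (by linarith [le_abs_self K]) dist_nonneg)
  have hK : 0 < |K| + 1 := by positivity
  rw [absolutelyContinuousOnInterval_iff] at hg ⊢
  intro ε hε
  obtain ⟨δ, hδ, H⟩ := hg (ε / (|K| + 1)) (by positivity)
  refine ⟨δ, hδ, fun E hE hE' => ?_⟩
  calc ∑ i ∈ Finset.range E.1, dist (f (E.2 i).1) (f (E.2 i).2)
      ≤ ∑ i ∈ Finset.range E.1, (|K| + 1) * dist (g (E.2 i).1) (g (E.2 i).2) :=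
        Finset.sum_le_sum fun i hi => h' _ (hE.1 i hi).1 _ (hE.1 i hi).2
    _ = (|K| + 1) * ∑ i ∈ Finset.range E.1, dist (g (E.2 i).1) (g (E.2 i).2) := by
        rw [Finset.mul_sum]
    _ < (|K| + 1) * (ε / (|K| + 1)) := mul_lt_mul_of_pos_left (H E hE hE') hK
    _ = ε := by field_simp

theorem of_integral {E : Type*} [NormedAddCommGroup E] [NormedSpace ℝ E] {g : ℝ → E}
    {a b c : ℝ} (h : IntervalIntegrable g volume a b) (hc : c ∈ uIcc a b) :
    AbsolutelyContinuousOnInterval (fun x => ∫ t in c..x, g t) a b := by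
  have hi : ∀ x ∈ uIcc a b, ∀ y ∈ uIcc a b, IntervalIntegrable g volume x y :=
    fun x hx y hy => h.mono_set (uIcc_subset_uIcc hx hy)
  refine (h.norm.absolutelyContinuousOnInterval_intervalIntegral hc).of_dist_le (K := 1)
    fun x hx y hy => ?_
  rw [dist_comm, dist_comm (∫ t in c..x, ‖g t‖), dist_eq_norm, dist_eq_norm,
    intervalIntegral.integral_interval_sub_left (hi c hc y hy) (hi c hc x hx),
    intervalIntegral.integral_interval_sub_left (hi c hc y hy).norm (hi c hc x hx).norm, one_mul]
  exact intervalIntegral.norm_integral_le_abs_integral_norm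

theorem ae_differentiableAt_complex {f : ℝ → ℂ} {a b : ℝ}
    (hf : AbsolutelyContinuousOnInterval f a b) :
    ∀ᵐ (x : ℝ), x ∈ uIcc a b → DifferentiableAt ℝ f x :=
  hf.boundedVariationOn.ae_differentiableAt_of_mem_uIcc

theorem re {f : ℝ → ℂ} {a b : ℝ} (hf : AbsolutelyContinuousOnInterval f a b) :
    AbsolutelyContinuousOnInterval (fun x => (f x).re) a b :=
  hf.of_dist_le (K := 1) fun x _ y _ => by
    rw [one_mul, dist_eq_norm, dist_eq_norm, Real.norm_eq_abs, ← Complex.sub_re]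
    exact Complex.abs_re_le_norm _

theorem im {f : ℝ → ℂ} {a b : ℝ} (hf : AbsolutelyContinuousOnInterval f a b) :
    AbsolutelyContinuousOnInterval (fun x => (f x).im) a b :=
  hf.of_dist_le (K := 1) fun x _ y _ => by
    rw [one_mul, dist_eq_norm, dist_eq_norm, Real.norm_eq_abs, ← Complex.sub_im]
    exact Complex.abs_im_le_norm _

theorem ae_deriv_eq_re_im {f : ℝ → ℂ} {a b : ℝ} (hf : AbsolutelyContinuousOnInterval f a b) :
    ∀ᵐ x : ℝ, x ∈ uIoc a b → ((deriv (fun x => (f x).re) x : ℝ) : ℂ) +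
      ((deriv (fun x => (f x).im) x : ℝ) : ℂ) * Complex.I = deriv f x := by
  filter_upwards [hf.ae_differentiableAt_complex] with x hx hxm
  have hd := (hx (uIoc_subset_uIcc hxm)).hasDerivAt
  have h1 : HasDerivAt (fun x => (f x).re) (deriv f x).re x :=
    Complex.reCLM.hasFDerivAt.comp_hasDerivAt x hd
  have h2 : HasDerivAt (fun x => (f x).im) (deriv f x).im x :=
    Complex.imCLM.hasFDerivAt.comp_hasDerivAt x hd
  rw [h1.deriv, h2.deriv, Complex.re_add_im]

theorem intervalIntegrable_deriv_complex {f : ℝ → ℂ} {a b : ℝ}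
    (hf : AbsolutelyContinuousOnInterval f a b) : IntervalIntegrable (deriv f) volume a b := by
  refine IntervalIntegrable.congr_ae (f := fun x => ((deriv (fun x => (f x).re) x : ℝ) : ℂ) +
      ((deriv (fun x => (f x).im) x : ℝ) : ℂ) * Complex.I) ?_ ?_
  · exact hf.re.intervalIntegrable_deriv.complex_ofReal.add
      (hf.im.intervalIntegrable_deriv.complex_ofReal.mul_const _)
  · rw [EventuallyEq, ae_restrict_iff' measurableSet_uIoc]
    exact hf.ae_deriv_eq_re_im

theorem integral_deriv_eq_sub_complex {f : ℝ → ℂ} {a b : ℝ}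
    (hf : AbsolutelyContinuousOnInterval f a b) : ∫ x in a..b, deriv f x = f b - f a := by
  rw [← intervalIntegral.integral_congr_ae hf.ae_deriv_eq_re_im,
    intervalIntegral.integral_add hf.re.intervalIntegrable_deriv.complex_ofReal
      (hf.im.intervalIntegrable_deriv.complex_ofReal.mul_const _),
    intervalIntegral.integral_mul_const, intervalIntegral.integral_ofReal,
    intervalIntegral.integral_ofReal, hf.re.integral_deriv_eq_sub, hf.im.integral_deriv_eq_sub]
  apply Complex.ext <;> simp

theorem mul_complex {f g : ℝ → ℂ} {a b : ℝ} (hf : AbsolutelyContinuousOnInterval f a b)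
    (hg : AbsolutelyContinuousOnInterval g a b) :
    AbsolutelyContinuousOnInterval (fun x => f x * g x) a b :=
  hf.smul hg

end AbsolutelyContinuousOnInterval

/-! ### Locally integrable functions on an open interval -/

namespace MeasureTheory.LocallyIntegrableOn

variable {E : Type*} [NormedAddCommGroup E] {I : Set ℝ} {g : ℝ → E}

theorem intervalIntegrable (hg : LocallyIntegrableOn g I volume) (hI : OrdConnected I) {x y : ℝ}
    (hx : x ∈ I) (hy : y ∈ I) : IntervalIntegrable g volume x y :=
  (hg.integrableOn_compact_subset (hI.uIcc_subset hx hy) isCompact_uIcc).intervalIntegrable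

variable [NormedSpace ℝ E]

theorem continuousOn_integral (hg : LocallyIntegrableOn g I volume) (hI : OrdConnected I)
    (hIo : IsOpen I) {c : ℝ} (hc : c ∈ I) : ContinuousOn (fun x => ∫ t in c..x, g t) I := by
  intro x hx
  obtain ⟨ε, hε, hb⟩ := Metric.isOpen_iff.1 hIo x hx
  have hl : x - ε / 2 ∈ I := hb (by simp [abs_of_pos hε]; linarith)
  have hr : x + ε / 2 ∈ I := hb (by simp [abs_of_pos hε]; linarith)
  have h := intervalIntegral.continuousOn_primitive_interval' (a := c) (b₁ := min c (x - ε / 2))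
    (b₂ := max c (x + ε / 2)) (μ := volume) (f := g)
    (hg.intervalIntegrable hI (by rcases min_choice c (x - ε / 2) with h | h <;> rwa [h])
      (by rcases max_choice c (x + ε / 2) with h | h <;> rwa [h]))
    (by rw [uIcc_of_le (by simp)]; exact ⟨min_le_left _ _, le_max_left _ _⟩)
  rw [uIcc_of_le (by simp)] at h
  refine (h.continuousAt (Icc_mem_nhds ?_ ?_)).continuousWithinAt
  · exact (min_le_right _ _).trans_lt (by linarith)
  · exact lt_of_lt_of_le (by linarith) (le_max_right _ _)

theorem ae_hasDerivAt_integral [CompleteSpace E] (hg : LocallyIntegrableOn g I volume)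
    (hI : OrdConnected I) (hIo : IsOpen I) {c : ℝ} (hc : c ∈ I) :
    ∀ᵐ x ∂(volume.restrict I), HasDerivAt (fun x => ∫ t in c..x, g t) (g x) x := by
  rw [ae_iff, Measure.restrict_apply₀' hIo.measurableSet.nullMeasurableSet]
  refine measure_null_of_locally_null _ fun x hx => ?_
  obtain ⟨ε, hε, hb⟩ := Metric.isOpen_iff.1 hIo x hx.2
  have hl : x - ε / 2 ∈ I := hb (by simp [abs_of_pos hε]; linarith)
  have hr : x + ε / 2 ∈ I := hb (by simp [abs_of_pos hε]; linarith)
  have hi := hg.intervalIntegrable hI (x := min c (x - ε / 2)) (y := max c (x + ε / 2))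
    (by rcases min_choice c (x - ε / 2) with h | h <;> rwa [h])
    (by rcases max_choice c (x + ε / 2) with h | h <;> rwa [h])
  have hle : min c (x - ε / 2) ≤ max c (x + ε / 2) := (min_le_left _ _).trans (le_max_left _ _)
  have h := hi.ae_hasDerivAt_integral
  rw [ae_iff, uIcc_of_le hle] at h
  refine ⟨_ ∩ Icc (min c (x - ε / 2)) (max c (x + ε / 2)), inter_mem_nhdsWithin _
    (Icc_mem_nhds ((min_le_right _ _).trans_lt (by linarith))
      (lt_of_lt_of_le (by linarith) (le_max_right _ _))), measure_mono_null ?_ h⟩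
  intro y hy hy'
  exact hy.1.1 (hy' hy.2 c ⟨min_le_left _ _, le_max_left _ _⟩)

end MeasureTheory.LocallyIntegrableOn

/-! ### Linear integral equations with locally integrable coefficients -/

section VolterraEquation

variable {I : Set ℝ} {c : ℝ} {k : ℝ → ℝ}

theorem integral_mul_exp_integral {c x : ℝ} (hk : IntervalIntegrable k volume c x) :
    ∫ t in c..x, k t * Real.exp (2 * ∫ u in c..t, k u) =
      (Real.exp (2 * ∫ u in c..x, k u) - 1) / 2 := by
  set κ : ℝ → ℝ := fun t => ∫ u in c..t, k u with hκ
  have hac : AbsolutelyContinuousOnInterval κ c x :=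
    hk.absolutelyContinuousOnInterval_intervalIntegral left_mem_uIcc
  obtain ⟨M, hM⟩ := hac.exists_bound
  obtain ⟨K, hK⟩ := ContDiffOn.exists_lipschitzOnWith (n := 1) (s := Icc (-M) M)
    (f := fun y : ℝ => Real.exp (2 * y))
    (by fun_prop) (by simp) (convex_Icc _ _) isCompact_Icc
  have hexp : AbsolutelyContinuousOnInterval (fun t => Real.exp (2 * κ t)) c x :=
    hac.of_dist_le (K := K) fun s hs t ht => hK.dist_le_mul _ (abs_le.1 (hM s hs)) _
      (abs_le.1 (hM t ht))
  have h := hexp.integral_deriv_eq_sub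
  have h2 : ∫ t in c..x, deriv (fun t => Real.exp (2 * κ t)) t =
      ∫ t in c..x, 2 * (k t * Real.exp (2 * κ t)) := by
    refine intervalIntegral.integral_congr_ae ?_
    filter_upwards [hk.ae_hasDerivAt_integral] with t ht htm
    have := ((ht (uIoc_subset_uIcc htm) c left_mem_uIcc).const_mul 2).exp
    rw [this.deriv]
    ring
  rw [h2, intervalIntegral.integral_const_mul] at h
  have h0 : κ c = 0 := by simp [hκ]
  rw [h0] at h
  simp only [mul_zero, Real.exp_zero] at h
  linarith

theorem abs_integral_of_nonneg (hk0 : ∀ t, 0 ≤ k t) (c x : ℝ) :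
    |∫ t in c..x, k t| = ∫ t in uIoc c x, k t := by
  rw [← Real.norm_eq_abs, intervalIntegral.norm_integral_eq_norm_integral_uIoc,
    Real.norm_of_nonneg (integral_nonneg hk0)]

theorem abs_integral_mul_exp_abs_integral (hk0 : ∀ t, 0 ≤ k t) {c x : ℝ}
    (hk : IntervalIntegrable k volume c x) :
    |∫ t in c..x, k t * Real.exp (2 * |∫ u in c..t, k u|)| =
      (Real.exp (2 * |∫ u in c..x, k u|) - 1) / 2 := by
  have key : ∀ {k : ℝ → ℝ} {c x : ℝ}, (∀ t, 0 ≤ k t) → IntervalIntegrable k volume c x → c ≤ x →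
      |∫ t in c..x, k t * Real.exp (2 * |∫ u in c..t, k u|)| =
      (Real.exp (2 * |∫ u in c..x, k u|) - 1) / 2 := by
    intro k c x hk0 hk hcx
    have hpos : ∀ t, c ≤ t → 0 ≤ ∫ u in c..t, k u := fun t ht =>
      intervalIntegral.integral_nonneg ht fun u _ => hk0 u
    have h1 : ∫ t in c..x, k t * Real.exp (2 * |∫ u in c..t, k u|) =
        ∫ t in c..x, k t * Real.exp (2 * ∫ u in c..t, k u) := by
      refine intervalIntegral.integral_congr fun t ht => ?_
      rw [uIcc_of_le hcx] at ht
      simp only [abs_of_nonneg (hpos t ht.1)]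
    rw [h1, integral_mul_exp_integral hk, abs_of_nonneg (hpos x hcx), abs_of_nonneg]
    have := Real.one_le_exp (x := 2 * ∫ u in c..x, k u) (by linarith [hpos x hcx])
    linarith
  rcases le_total c x with hcx | hcx
  · exact key hk0 hk hcx
  · have h := key (k := fun t => k (-t)) (c := -c) (x := -x) (fun t => hk0 _)
      (by simpa using hk.comp_sub_left 0) (by linarith)
    have e1 : ∀ t, ∫ u in -c..t, k (-u) = -∫ u in c..(-t), k u := fun t => by
      rw [intervalIntegral.integral_comp_neg, neg_neg, intervalIntegral.integral_symm]
    simp only [e1, abs_neg, neg_neg] at h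
    rw [← h, intervalIntegral.integral_comp_neg
      (fun t => k t * Real.exp (2 * |∫ u in c..t, k u|)), neg_neg, neg_neg,
      intervalIntegral.integral_symm, abs_neg]

/-- A Grönwall estimate with a locally integrable kernel. -/
theorem gronwall_of_locallyIntegrableOn (hI : OrdConnected I) (hIo : IsOpen I) (hc : c ∈ I)
    (hk : LocallyIntegrableOn k I volume) (hk0 : ∀ t, 0 ≤ k t) {N : ℝ → ℝ} {N₀ : ℝ}
    (hN : ContinuousOn N I) (hN0 : ∀ t, 0 ≤ N t) (hN₀ : 0 ≤ N₀) {x : ℝ} (hx : x ∈ I)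
    (h : ∀ t ∈ uIcc c x, N t ≤ N₀ + |∫ u in c..t, k u * N u|) :
    N x ≤ 2 * N₀ * Real.exp (2 * |∫ u in c..x, k u|) := by
  set K : ℝ → ℝ := fun t => |∫ u in c..t, k u| with hK
  have hKc : ContinuousOn K I := (hk.continuousOn_integral hI hIo hc).abs
  have hsub : uIcc c x ⊆ I := hI.uIcc_subset hc hx
  have hcont : ContinuousOn (fun t => N t * Real.exp (-(2 * K t))) (uIcc c x) :=
    (hN.mul (Real.continuous_exp.comp_continuousOn (hKc.const_mul 2).neg)).mono hsub
  obtain ⟨t₀, ht₀, hmax⟩ := isCompact_uIcc.exists_isMaxOn nonempty_uIcc hcont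
  set L := N t₀ * Real.exp (-(2 * K t₀)) with hL
  have hL0 : 0 ≤ L := mul_nonneg (hN0 _) (Real.exp_pos _).le
  have hle : ∀ t ∈ uIcc c x, N t ≤ L * Real.exp (2 * K t) := fun t ht => by
    have := mul_le_mul_of_nonneg_right (hmax ht) (Real.exp_pos (2 * K t)).le
    rwa [mul_assoc, ← Real.exp_add, neg_add_cancel, Real.exp_zero, mul_one] at this
  have hsub' : uIcc c t₀ ⊆ uIcc c x := uIcc_subset_uIcc left_mem_uIcc ht₀
  have hki : IntervalIntegrable k volume c t₀ := hk.intervalIntegrable hI hc (hsub ht₀)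
  have hint : |∫ u in c..t₀, k u * N u| ≤ L * ((Real.exp (2 * K t₀) - 1) / 2) := by
    rw [← abs_integral_mul_exp_abs_integral hk0 hki,
      abs_integral_of_nonneg (fun t => mul_nonneg (hk0 t) (hN0 t)),
      abs_integral_of_nonneg (fun t => mul_nonneg (hk0 t) (Real.exp_pos _).le),
      ← integral_const_mul]
    refine setIntegral_mono_on ?_ ?_ measurableSet_uIoc fun t ht => ?_
    · exact (intervalIntegrable_iff.1 (hki.mul_continuousOn (hN.mono (hsub'.trans hsub))))
    · refine Integrable.const_mul (intervalIntegrable_iff.1 (hki.mul_continuousOn ?_)) _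
      exact Real.continuous_exp.comp_continuousOn
        ((hKc.const_mul 2).mono (hsub'.trans hsub))
    · have := mul_le_mul_of_nonneg_left (hle t (hsub' (uIoc_subset_uIcc ht))) (hk0 t)
      linarith
  have h1 := (h t₀ ht₀).trans (add_le_add_right hint N₀)
  have hE : 1 ≤ Real.exp (2 * K t₀) := Real.one_le_exp (by positivity)
  have h2 : N t₀ = L * Real.exp (2 * K t₀) := by
    rw [hL, mul_assoc, ← Real.exp_add, neg_add_cancel, Real.exp_zero, mul_one]
  have hLN : L ≤ 2 * N₀ := by nlinarith
  exact (hle x right_mem_uIcc).trans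
    (mul_le_mul_of_nonneg_right hLN (Real.exp_pos _).le)

variable {E : Type*} [NormedAddCommGroup E] [NormedSpace ℝ E]

theorem locallyIntegrableOn_clm_apply (hIo : IsOpen I) {A : ℝ → E →L[ℝ] E} {Y : ℝ → E}
    (hA : LocallyIntegrableOn A I volume) (hY : ContinuousOn Y I) :
    LocallyIntegrableOn (fun t => A t (Y t)) I volume := by
  rw [locallyIntegrableOn_iff hIo.isLocallyClosed] at hA ⊢
  intro K hKI hK
  obtain ⟨C, hC⟩ := hK.exists_bound_of_continuousOn (hY.mono hKI)
  have h1 := hA K hKI hK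
  refine Integrable.mono' (g := fun t => ‖A t‖ * C) (h1.norm.mul_const C) ?_ ?_
  · exact (ContinuousLinearMap.apply ℝ E).flip.aestronglyMeasurable_comp₂
      h1.aestronglyMeasurable ((hY.mono hKI).aestronglyMeasurable_of_isCompact hK hK.measurableSet)
  · filter_upwards [ae_restrict_mem hK.measurableSet] with t ht
    exact (A t).le_opNorm_of_le (hC t ht)

/-- Existence of a global solution of a linear integral equation on an open interval. -/
theorem exists_solution_linear_integral_equation [CompleteSpace E] (hI : OrdConnected I)
    (hIo : IsOpen I) (hc : c ∈ I) {A : ℝ → E →L[ℝ] E} {g : ℝ → E} (hA : LocallyIntegrableOn A I volume)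
    (hg : LocallyIntegrableOn g I volume) (y₀ : E) :
    ∃ Y : ℝ → E, ContinuousOn Y I ∧
      ∀ x ∈ I, Y x = y₀ + ∫ t in c..x, (A t (Y t) + g t) := by
  set k : ℝ → ℝ := fun t => ‖A t‖ + ‖g t‖ with hkdef
  have hk : LocallyIntegrableOn k I volume := hA.norm.add hg.norm
  have hk0 : ∀ t, 0 ≤ k t := fun t => by positivity
  set K : ℝ → ℝ := fun t => |∫ u in c..t, k u| with hKdef
  have hKc : ContinuousOn K I := (hk.continuousOn_integral hI hIo hc).abs
  have hK0 : ∀ t, 0 ≤ K t := fun t => abs_nonneg _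
  have hmaj : ∀ {Y : ℝ → E} {L : ℝ}, 0 ≤ L → ContinuousOn Y I →
      (∀ t ∈ I, ‖Y t‖ ≤ L * Real.exp (2 * K t)) → ∀ x ∈ I,
      ‖∫ t in c..x, A t (Y t)‖ ≤ L * ((Real.exp (2 * K x) - 1) / 2) := by
    intro Y L hL hY hb x hx
    have hki : IntervalIntegrable k volume c x := hk.intervalIntegrable hI hc hx
    have hsub : uIcc c x ⊆ I := hI.uIcc_subset hc hx
    rw [← abs_integral_mul_exp_abs_integral hk0 hki,
      abs_integral_of_nonneg (fun t => mul_nonneg (hk0 t) (Real.exp_pos _).le),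
      ← integral_const_mul, intervalIntegral.norm_integral_eq_norm_integral_uIoc]
    refine norm_integral_le_of_norm_le
      (Integrable.const_mul (intervalIntegrable_iff.1 (hki.mul_continuousOn
        (Real.continuous_exp.comp_continuousOn ((hKc.const_mul 2).mono hsub)))) _) ?_
    filter_upwards [ae_restrict_mem measurableSet_uIoc] with t ht
    have htI := hsub (uIoc_subset_uIcc ht)
    calc ‖A t (Y t)‖ ≤ ‖A t‖ * ‖Y t‖ := (A t).le_opNorm _
      _ ≤ k t * (L * Real.exp (2 * K t)) :=
        mul_le_mul (by simp [hkdef]) (hb t htI) (norm_nonneg _) (hk0 t)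
      _ = L * (k t * Real.exp (2 * K t)) := by ring
  have hgb : ∀ x ∈ I, ‖∫ t in c..x, g t‖ ≤ K x := by
    intro x hx
    have hki : IntervalIntegrable k volume c x := hk.intervalIntegrable hI hc hx
    rw [hKdef, intervalIntegral.norm_integral_eq_norm_integral_uIoc]
    simp only [abs_integral_of_nonneg hk0]
    exact norm_integral_le_of_norm_le (intervalIntegrable_iff.1 hki)
      (Eventually.of_forall fun t => by simp [hkdef])
  let lift : BoundedContinuousFunction I E → ℝ → E := fun Z t =>
    Real.exp (2 * K t) • Function.extend Subtype.val (Z : I → E) 0 t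
  have lift_apply : ∀ Z (x : I), lift Z x = Real.exp (2 * K x) • Z x := fun Z x => by
    simp only [lift, Subtype.val_injective.extend_apply]
  have hexpc : ContinuousOn (fun t => Real.exp (2 * K t)) I :=
    Real.continuous_exp.comp_continuousOn (hKc.const_mul 2)
  have lift_cont : ∀ Z, ContinuousOn (lift Z) I := fun Z => by
    refine hexpc.smul ?_
    rw [continuousOn_iff_continuous_domRestrict]
    convert Z.continuous using 1
    ext x
    simp
  have lift_norm : ∀ Z : BoundedContinuousFunction I E, ∀ t ∈ I,
      ‖lift Z t‖ ≤ ‖Z‖ * Real.exp (2 * K t) := fun Z t ht => by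
    rw [lift_apply Z ⟨t, ht⟩, norm_smul, Real.norm_of_nonneg (Real.exp_pos _).le, mul_comm]
    exact mul_le_mul_of_nonneg_right (Z.norm_coe_le_norm _) (Real.exp_pos _).le
  have lift_sub : ∀ Z Z' : BoundedContinuousFunction I E, ∀ t ∈ I,
      lift Z t - lift Z' t = lift (Z - Z') t := fun Z Z' t ht => by
    rw [lift_apply Z ⟨t, ht⟩, lift_apply Z' ⟨t, ht⟩, lift_apply _ ⟨t, ht⟩, ← smul_sub]
    rfl
  have hloc : ∀ Z, LocallyIntegrableOn (fun t => A t (lift Z t)) I volume := fun Z =>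
    locallyIntegrableOn_clm_apply hIo hA (lift_cont Z)
  have hadd : ∀ Z, ∀ x ∈ I, ∫ t in c..x, (A t (lift Z t) + g t) =
      (∫ t in c..x, A t (lift Z t)) + ∫ t in c..x, g t := fun Z x hx =>
    intervalIntegral.integral_add ((hloc Z).intervalIntegrable hI hc hx)
      (hg.intervalIntegrable hI hc hx)
  have hexp_bound : ∀ (t C : ℝ), 0 ≤ t → 0 ≤ C → Real.exp (-(2 * t)) *
      (C * ((Real.exp (2 * t) - 1) / 2)) ≤ C / 2 := fun t C ht hC => by
    have h1 : Real.exp (-(2 * t)) * Real.exp (2 * t) = 1 := by rw [← Real.exp_add]; simp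
    have h2 := Real.exp_pos (-(2 * t))
    nlinarith [mul_nonneg hC h2.le]
  let Φ : BoundedContinuousFunction I E → BoundedContinuousFunction I E := fun Z =>
    BoundedContinuousFunction.ofNormedAddCommGroup
      (fun x : I => Real.exp (-(2 * K x)) • (y₀ + ∫ t in c..(x : ℝ), (A t (lift Z t) + g t)))
      (by
        refine Continuous.smul (Real.continuous_exp.comp (continuousOn_iff_continuous_domRestrict.1
          ((hKc.const_mul 2).neg))) (continuous_const.add ?_)
        exact continuousOn_iff_continuous_domRestrict.1
          (((hloc Z).add hg).continuousOn_integral hI hIo hc))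
      (‖y₀‖ + ‖Z‖ / 2 + 1) (by
        rintro ⟨x, hx⟩
        rw [norm_smul, Real.norm_of_nonneg (Real.exp_pos _).le, hadd Z x hx]
        have h1 := hmaj (norm_nonneg Z) (lift_cont Z) (lift_norm Z) x hx
        have h2 := hgb x hx
        have h3 := norm_add_le y₀ ((∫ t in c..x, A t (lift Z t)) + ∫ t in c..x, g t)
        have h4 := norm_add_le (∫ t in c..x, A t (lift Z t)) (∫ t in c..x, g t)
        have h5 := hexp_bound (K x) ‖Z‖ (hK0 x) (norm_nonneg _)
        have h6 : Real.exp (-(2 * K x)) * (1 + 2 * K x) ≤ 1 := by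
          have := Real.add_one_le_exp (2 * K x)
          calc Real.exp (-(2 * K x)) * (1 + 2 * K x)
              ≤ Real.exp (-(2 * K x)) * Real.exp (2 * K x) :=
                mul_le_mul_of_nonneg_left (by linarith) (Real.exp_pos _).le
            _ = 1 := by rw [← Real.exp_add]; simp
        have h7 : Real.exp (-(2 * K x)) ≤ 1 :=
          Real.exp_le_one_iff.2 (by linarith [hK0 x])
        have h8 := Real.exp_pos (-(2 * K x))
        calc Real.exp (-(2 * K x)) * _
            ≤ Real.exp (-(2 * K x)) *
              (‖y₀‖ + (‖Z‖ * ((Real.exp (2 * K x) - 1) / 2) + K x)) :=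
                mul_le_mul_of_nonneg_left (by linarith) h8.le
          _ = Real.exp (-(2 * K x)) * ‖y₀‖ +
              Real.exp (-(2 * K x)) * (‖Z‖ * ((Real.exp (2 * K x) - 1) / 2)) +
              Real.exp (-(2 * K x)) * K x := by ring
          _ ≤ ‖y₀‖ + ‖Z‖ / 2 + 1 := by
              have := mul_le_of_le_one_left (norm_nonneg y₀) h7
              have := mul_nonneg h8.le (hK0 x)
              nlinarith)
  have Φ_apply : ∀ Z (x : I), Φ Z x =
      Real.exp (-(2 * K x)) • (y₀ + ∫ t in c..(x : ℝ), (A t (lift Z t) + g t)) :=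
    fun _ _ => rfl
  have hΦ : ContractingWith (1 / 2) Φ := by
    refine ⟨by norm_num, LipschitzWith.of_dist_le_mul fun Z Z' => ?_⟩
    rw [BoundedContinuousFunction.dist_le (by positivity)]
    rintro ⟨x, hx⟩
    rw [dist_eq_norm, Φ_apply, Φ_apply, ← smul_sub, hadd Z x hx, hadd Z' x hx,
      add_sub_add_left_eq_sub, add_sub_add_right_eq_sub, ← intervalIntegral.integral_sub
      ((hloc Z).intervalIntegrable hI hc hx) ((hloc Z').intervalIntegrable hI hc hx),
      norm_smul, Real.norm_of_nonneg (Real.exp_pos _).le, dist_eq_norm]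
    have h1 : ∫ t in c..x, (A t (lift Z t) - A t (lift Z' t)) =
        ∫ t in c..x, A t (lift (Z - Z') t) := by
      refine intervalIntegral.integral_congr fun t ht => ?_
      rw [← map_sub, lift_sub Z Z' t (hI.uIcc_subset hc hx ht)]
    rw [h1]
    refine (mul_le_mul_of_nonneg_left (hmaj (norm_nonneg _) (lift_cont _) (lift_norm _) x hx)
      (Real.exp_pos _).le).trans ((hexp_bound _ _ (hK0 x) (norm_nonneg _)).trans ?_)
    simp
    linarith
  have hfix := hΦ.fixedPoint_isFixedPt
  set Z := ContractingWith.fixedPoint Φ hΦ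
  refine ⟨lift Z, lift_cont Z, fun x hx => ?_⟩
  have h := congrArg (fun F : BoundedContinuousFunction I E => F ⟨x, hx⟩) hfix
  simp only [Φ_apply] at h
  rw [lift_apply Z ⟨x, hx⟩, ← h, smul_smul, ← Real.exp_add]
  simp

end VolterraEquation

namespace SturmLiouville

variable {τ : SturmLiouville}

/-! ### Absolutely continuous functions on the interval `(a, b)` -/

lemma nonempty_I (τ : SturmLiouville) : τ.I.Nonempty := by
  obtain ⟨x, h1, h2⟩ := EReal.lt_iff_exists_real_btwn.1 τ.a_lt_b
  exact ⟨x, h1, h2⟩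

lemma acLoc_of_integral {E : Type*} [NormedAddCommGroup E] [NormedSpace ℝ E]
    {g : ℝ → E} {L : E →L[ℝ] ℂ} {f : ℝ → E} {c : ℝ} {y : E}
    (hg : LocallyIntegrableOn g τ.I volume) (hc : c ∈ τ.I)
    (h : ∀ x ∈ τ.I, f x = y + ∫ t in c..x, g t) : τ.ACLoc (fun x => L (f x)) := by
  intro α hα β hβ
  have hsub := τ.ordConnected_I.uIcc_subset hα hβ
  have hi := hg.intervalIntegrable τ.ordConnected_I hα hβ
  refine (AbsolutelyContinuousOnInterval.of_integral hi left_mem_uIcc).of_dist_le (K := ‖L‖)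
    fun x hx y hy => ?_
  have hint : ∀ {u v}, u ∈ τ.I → v ∈ τ.I → IntervalIntegrable g volume u v :=
    fun hu hv => hg.intervalIntegrable τ.ordConnected_I hu hv
  rw [dist_eq_norm, dist_eq_norm, ← map_sub, h x (hsub hx), h y (hsub hy),
    add_sub_add_left_eq_sub, intervalIntegral.integral_interval_sub_left
    (hint hc (hsub hx)) (hint hc (hsub hy)), intervalIntegral.integral_interval_sub_left
    (hint hα (hsub hx)) (hint hα (hsub hy))]
  exact L.le_opNorm _

lemma ae_hasDerivAt_of_integral {E : Type*} [NormedAddCommGroup E] [NormedSpace ℝ E]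
    [CompleteSpace E] {g : ℝ → E} {f : ℝ → E} {c : ℝ} {y : E}
    (hg : LocallyIntegrableOn g τ.I volume) (hc : c ∈ τ.I)
    (h : ∀ x ∈ τ.I, f x = y + ∫ t in c..x, g t) :
    ∀ᵐ x ∂(volume.restrict τ.I), HasDerivAt f (g x) x := by
  filter_upwards [hg.ae_hasDerivAt_integral τ.ordConnected_I τ.isOpen_I hc,
    ae_restrict_mem τ.measurableSet_I] with x hx hxI
  refine (hx.const_add y).congr_of_eventuallyEq ?_
  filter_upwards [τ.isOpen_I.mem_nhds hxI] with t ht using h t ht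

lemma uIoc_ae_of_ae_restrict {P : ℝ → Prop} (h : ∀ᵐ x ∂(volume.restrict τ.I), P x) {α β : ℝ}
    (hα : α ∈ τ.I) (hβ : β ∈ τ.I) : ∀ᵐ x, x ∈ uIoc α β → P x := by
  rw [ae_restrict_iff' τ.measurableSet_I] at h
  filter_upwards [h] with x hx hxm
  exact hx (τ.ordConnected_I.uIcc_subset hα hβ (uIoc_subset_uIcc hxm))

lemma ACLoc.integral_eq_sub {f g : ℝ → ℂ} (hf : τ.ACLoc f)
    (h : ∀ᵐ x ∂(volume.restrict τ.I), HasDerivAt f (g x) x) {α β : ℝ} (hα : α ∈ τ.I)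
    (hβ : β ∈ τ.I) : IntervalIntegrable g volume α β ∧ ∫ x in α..β, g x = f β - f α := by
  have h' : ∀ᵐ x, x ∈ uIoc α β → deriv f x = g x := by
    filter_upwards [uIoc_ae_of_ae_restrict h hα hβ] with x hx hxm using (hx hxm).deriv
  refine ⟨(hf α hα β hβ).intervalIntegrable_deriv_complex.congr_ae ?_, ?_⟩
  · rwa [EventuallyEq, ae_restrict_iff' measurableSet_uIoc]
  · rw [← intervalIntegral.integral_congr_ae h', (hf α hα β hβ).integral_deriv_eq_sub_complex]

lemma ACLoc.mul {f g : ℝ → ℂ} (hf : τ.ACLoc f) (hg : τ.ACLoc g) :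
    τ.ACLoc (fun x => f x * g x) := fun α hα β hβ =>
  (hf α hα β hβ).mul_complex (hg α hα β hβ)

lemma ACLoc.sub {f g : ℝ → ℂ} (hf : τ.ACLoc f) (hg : τ.ACLoc g) :
    τ.ACLoc (fun x => f x - g x) := fun α hα β hβ => (hf α hα β hβ).sub (hg α hα β hβ)

lemma ACLoc.conj {f : ℝ → ℂ} (hf : τ.ACLoc f) : τ.ACLoc (fun x => star (f x)) :=
  fun α hα β hβ => (hf α hα β hβ).of_dist_le (K := 1) fun x _ y _ => by
    rw [one_mul, dist_star_star]

/-! ### Quasi-derivatives -/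

namespace IsQuasiDeriv

variable {f f₁ g g₁ : ℝ → ℂ}

lemma ae_hasDerivAt (hf : τ.IsQuasiDeriv f f₁) : ∀ᵐ x ∂(volume.restrict τ.I),
    HasDerivAt f (((τ.p x)⁻¹ : ℝ) * f₁ x - τ.s x * f x) x := by
  filter_upwards [hf.ac.ae_differentiableAt, hf.eq, (show ∀ᵐ x ∂(volume.restrict τ.I), τ.p x ≠ 0
    from τ.p_ne_zero)] with x h1 h2 h3
  have h3' : (τ.p x : ℂ) ≠ 0 := by exact_mod_cast h3
  refine h1.hasDerivAt.congr_deriv ?_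
  rw [h2]
  push_cast
  field_simp
  ring

lemma ae_hasDerivAt₁ (hf : τ.IsQuasiDeriv f f₁) : ∀ᵐ x ∂(volume.restrict τ.I),
    HasDerivAt f₁ (τ.s x * f₁ x + τ.q x * f x - τ.r x * τ.expr f f₁ x) x := by
  filter_upwards [hf.ac₁.ae_differentiableAt, (show ∀ᵐ x ∂(volume.restrict τ.I), 0 < τ.r x
    from τ.r_pos)] with x h1 h3
  have h3' : (τ.r x : ℂ) ≠ 0 := by exact_mod_cast h3.ne'
  refine h1.hasDerivAt.congr_deriv ?_
  rw [expr]
  field_simp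
  ring

lemma conj (hf : τ.IsQuasiDeriv f f₁) :
    τ.IsQuasiDeriv (fun x => star (f x)) (fun x => star (f₁ x)) where
  ac := hf.ac.conj
  ac₁ := hf.ac₁.conj
  eq := by
    filter_upwards [hf.eq] with x h1
    rw [h1, deriv.star]
    simp

lemma expr_conj (τ : SturmLiouville) (f f₁ : ℝ → ℂ) (x : ℝ) :
    τ.expr (fun x => star (f x)) (fun x => star (f₁ x)) x = star (τ.expr f f₁ x) := by
  simp only [expr, deriv.star]
  simp

lemma expr_add (hf : τ.IsQuasiDeriv f f₁) (hg : τ.IsQuasiDeriv g g₁) :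
    ∀ᵐ x ∂(volume.restrict τ.I),
      τ.expr (f + g) (f₁ + g₁) x = τ.expr f f₁ x + τ.expr g g₁ x := by
  filter_upwards [hf.ac₁.ae_differentiableAt, hg.ac₁.ae_differentiableAt] with x h3 h4
  simp only [Pi.add_apply, expr]
  rw [deriv_add h3 h4]
  ring

lemma expr_smul (τ : SturmLiouville) (c : ℂ) (f f₁ : ℝ → ℂ) (x : ℝ) :
    τ.expr (c • f) (c • f₁) x = c * τ.expr f f₁ x := by
  simp only [Pi.smul_apply, expr]
  rw [deriv_const_smul_field]
  simp only [smul_eq_mul]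
  ring

end IsQuasiDeriv

/-- The modified Wronskian `W(f, g) = f g^[1] - f^[1] g`. -/
def wronskian (f f₁ g g₁ : ℝ → ℂ) (x : ℝ) : ℂ := f x * g₁ x - f₁ x * g x

/-- Lagrange's identity. -/
lemma IsQuasiDeriv.lagrange {f f₁ g g₁ : ℝ → ℂ} (hf : τ.IsQuasiDeriv f f₁)
    (hg : τ.IsQuasiDeriv g g₁) {α β : ℝ} (hα : α ∈ τ.I) (hβ : β ∈ τ.I) :
    IntervalIntegrable
      (fun x => (τ.r x : ℂ) * (τ.expr f f₁ x * g x - f x * τ.expr g g₁ x)) volume α β ∧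
    ∫ x in α..β, (τ.r x : ℂ) * (τ.expr f f₁ x * g x - f x * τ.expr g g₁ x) =
      wronskian f f₁ g g₁ β - wronskian f f₁ g g₁ α := by
  refine ACLoc.integral_eq_sub ((hf.ac.mul hg.ac₁).sub (hf.ac₁.mul hg.ac)) ?_ hα hβ
  filter_upwards [hf.ae_hasDerivAt, hf.ae_hasDerivAt₁, hg.ae_hasDerivAt, hg.ae_hasDerivAt₁]
    with x h1 h2 h3 h4
  refine ((h1.mul h4).sub (h2.mul h3)).congr_deriv ?_
  ring

/-! ### The initial value problem -/

theorem exists_initial_value (z : ℂ) {h : ℝ → ℂ}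
    (hh : LocallyIntegrableOn (fun x => (τ.r x : ℂ) * h x) τ.I volume) {c : ℝ} (hc : c ∈ τ.I)
    (d d₁ : ℂ) : ∃ f f₁ : ℝ → ℂ, τ.IsQuasiDeriv f f₁ ∧
      (∀ᵐ x ∂(volume.restrict τ.I), τ.expr f f₁ x = z * f x + h x) ∧ f c = d ∧ f₁ c = d₁ := by
  let π₁ : ℂ × ℂ →L[ℝ] ℂ := ContinuousLinearMap.fst ℝ ℂ ℂ
  let π₂ : ℂ × ℂ →L[ℝ] ℂ := ContinuousLinearMap.snd ℝ ℂ ℂ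
  let i₁ : ℂ →L[ℝ] ℂ × ℂ := ContinuousLinearMap.inl ℝ ℂ ℂ
  let i₂ : ℂ →L[ℝ] ℂ × ℂ := ContinuousLinearMap.inr ℝ ℂ ℂ
  let m : ℂ →L[ℝ] ℂ := ContinuousLinearMap.mul ℝ ℂ z
  let A : ℝ → (ℂ × ℂ →L[ℝ] ℂ × ℂ) := fun t =>
    τ.s t • (i₂ ∘L π₂ - i₁ ∘L π₁) + (τ.p t)⁻¹ • (i₁ ∘L π₂) + τ.q t • (i₂ ∘L π₁) -
      τ.r t • (i₂ ∘L m ∘L π₁)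
  have hsm : ∀ {k : ℝ → ℝ} (B : ℂ × ℂ →L[ℝ] ℂ × ℂ), LocallyIntegrableOn k τ.I volume →
      LocallyIntegrableOn (fun t => k t • B) τ.I volume := fun B hk x hx => by
    obtain ⟨U, hU, hi⟩ := hk x hx
    exact ⟨U, hU, hi.smul_const B⟩
  have hA : LocallyIntegrableOn A τ.I volume :=
    (((hsm _ τ.locInt_s).add (hsm _ τ.locInt_inv_p)).add (hsm _ τ.locInt_q)).sub
      (hsm _ τ.locInt_r)
  have hg : LocallyIntegrableOn (fun x => i₂ (-((τ.r x : ℂ) * h x))) τ.I volume :=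
    fun x hx => by
      obtain ⟨U, hU, hi⟩ := hh x hx
      exact ⟨U, hU, i₂.integrable_comp hi.neg⟩
  obtain ⟨Y, hY, hYeq⟩ := exists_solution_linear_integral_equation τ.ordConnected_I τ.isOpen_I hc
    hA hg (d, d₁)
  have hloc := (locallyIntegrableOn_clm_apply τ.isOpen_I hA hY).add hg
  have hder := ae_hasDerivAt_of_integral hloc hc hYeq
  have hp : ∀ᵐ x ∂(volume.restrict τ.I), τ.p x ≠ 0 := τ.p_ne_zero
  have hr : ∀ᵐ x ∂(volume.restrict τ.I), 0 < τ.r x := τ.r_pos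
  refine ⟨fun x => π₁ (Y x), fun x => π₂ (Y x), ⟨acLoc_of_integral hloc hc hYeq,
    acLoc_of_integral hloc hc hYeq, ?_⟩, ?_, ?_, ?_⟩
  · filter_upwards [hder, hp] with x hx hpx
    have hpx' : (τ.p x : ℂ) ≠ 0 := by exact_mod_cast hpx
    have h1 := (π₁.hasFDerivAt.comp_hasDerivAt x hx).deriv
    change deriv (fun x => π₁ (Y x)) x = _ at h1
    rw [h1]
    simp [A, π₁, π₂, i₁, i₂]
    field_simp
  · filter_upwards [hder, hr] with x hx hrx
    have hrx' : (τ.r x : ℂ) ≠ 0 := by exact_mod_cast hrx.ne'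
    have h1 := (π₂.hasFDerivAt.comp_hasDerivAt x hx).deriv
    change deriv (fun x => π₂ (Y x)) x = _ at h1
    rw [expr, h1]
    simp [A, π₁, π₂, i₁, i₂, m]
    field_simp
    ring
  · simp [hYeq c hc, π₁]
  · simp [hYeq c hc, π₂]

/-! ### Solutions and fundamental systems -/

/-- `u` is a solution of `(τ - z) u = 0` with first quasi-derivative `u₁`. -/
structure IsSolPair (τ : SturmLiouville) (z : ℂ) (u u₁ : ℝ → ℂ) : Prop where
  qd : τ.IsQuasiDeriv u u₁
  eq : ∀ᵐ x ∂(volume.restrict τ.I), τ.expr u u₁ x = z * u x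

lemma isSolution_iff {z : ℂ} {u : ℝ → ℂ} : τ.IsSolution z u ↔ ∃ u₁, τ.IsSolPair z u u₁ := by
  simp only [IsSolution, sub_eq_zero]
  exact ⟨fun ⟨u₁, h1, h2⟩ => ⟨u₁, h1, h2⟩, fun ⟨u₁, h⟩ => ⟨u₁, h.1, h.2⟩⟩

namespace IsSolPair

variable {z : ℂ} {u u₁ v v₁ : ℝ → ℂ}

lemma add (hu : τ.IsSolPair z u u₁) (hv : τ.IsSolPair z v v₁) :
    τ.IsSolPair z (u + v) (u₁ + v₁) where
  qd := hu.qd.add hv.qd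
  eq := by
    filter_upwards [hu.eq, hv.eq, hu.qd.expr_add hv.qd] with x h1 h2 h3
    rw [h3, h1, h2, Pi.add_apply, mul_add]

lemma smul (c : ℂ) (hu : τ.IsSolPair z u u₁) : τ.IsSolPair z (c • u) (c • u₁) where
  qd := hu.qd.smul c
  eq := by
    filter_upwards [hu.eq] with x h1
    rw [IsQuasiDeriv.expr_smul, h1, Pi.smul_apply, smul_eq_mul, mul_left_comm]

lemma conj (hu : τ.IsSolPair z u u₁) :
    τ.IsSolPair (star z) (fun x => star (u x)) (fun x => star (u₁ x)) where
  qd := hu.qd.conj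
  eq := by
    filter_upwards [hu.eq] with x h1
    rw [IsQuasiDeriv.expr_conj, h1, star_mul']

/-- The Wronskian of a function in the domain of `τ` and a solution. -/
lemma wronskian_sub {f f₁ h : ℝ → ℂ} (hu : τ.IsSolPair z u u₁) (hf : τ.IsQuasiDeriv f f₁)
    (hfh : ∀ᵐ x ∂(volume.restrict τ.I), τ.expr f f₁ x = z * f x + h x) {α β : ℝ}
    (hα : α ∈ τ.I) (hβ : β ∈ τ.I) :
    wronskian f f₁ u u₁ β - wronskian f f₁ u u₁ α = ∫ x in α..β, (τ.r x : ℂ) * (h x * u x) := by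
  rw [← (hf.lagrange hu.qd hα hβ).2]
  refine intervalIntegral.integral_congr_ae (uIoc_ae_of_ae_restrict ?_ hα hβ)
  filter_upwards [hu.eq, hfh] with x h1 h2
  rw [h1, h2]
  ring

lemma wronskian_const (hu : τ.IsSolPair z u u₁) (hv : τ.IsSolPair z v v₁) {α β : ℝ}
    (hα : α ∈ τ.I) (hβ : β ∈ τ.I) : wronskian v v₁ u u₁ β = wronskian v v₁ u u₁ α := by
  have := hu.wronskian_sub hv.qd (h := 0) (by simpa using hv.eq) hα hβ
  simpa [sub_eq_zero] using this

end IsSolPair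

/-- The fundamental system of `(τ - z) u = 0` with `θ(c) = φ^[1](c) = 1`,
`θ^[1](c) = φ(c) = 0`. -/
structure FundamentalSystem (τ : SturmLiouville) (z : ℂ) (c : ℝ) where
  θ : ℝ → ℂ
  θ₁ : ℝ → ℂ
  φ : ℝ → ℂ
  φ₁ : ℝ → ℂ
  mem : c ∈ τ.I
  sol_θ : τ.IsSolPair z θ θ₁
  sol_φ : τ.IsSolPair z φ φ₁
  θ_c : θ c = 1
  θ₁_c : θ₁ c = 0
  φ_c : φ c = 0
  φ₁_c : φ₁ c = 1

lemma nonempty_fundamentalSystem (z : ℂ) {c : ℝ} (hc : c ∈ τ.I) :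
    Nonempty (τ.FundamentalSystem z c) := by
  have h0 : LocallyIntegrableOn (fun x => (τ.r x : ℂ) * (0 : ℝ → ℂ) x) τ.I volume := by
    simpa using locallyIntegrableOn_zero
  obtain ⟨θ, θ₁, h1, h2, h3, h4⟩ := exists_initial_value z h0 hc 1 0
  obtain ⟨φ, φ₁, k1, k2, k3, k4⟩ := exists_initial_value z h0 hc 0 1
  exact ⟨⟨θ, θ₁, φ, φ₁, hc, ⟨h1, by simpa using h2⟩, ⟨k1, by simpa using k2⟩, h3, h4, k3, k4⟩⟩

namespace FundamentalSystem

variable {z : ℂ} {c : ℝ} (S : τ.FundamentalSystem z c)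

lemma wronskian_eq_one {x : ℝ} (hx : x ∈ τ.I) : S.θ x * S.φ₁ x - S.θ₁ x * S.φ x = 1 := by
  have := S.sol_φ.wronskian_const S.sol_θ S.mem hx
  simpa [wronskian, S.θ_c, S.θ₁_c, S.φ_c, S.φ₁_c] using this

/-- The solution with initial values `v` at `c`. -/
def comb (v : ℂ × ℂ) : ℝ → ℂ := v.1 • S.θ + v.2 • S.φ

/-- The first quasi-derivative of `S.comb v`. -/
def comb₁ (v : ℂ × ℂ) : ℝ → ℂ := v.1 • S.θ₁ + v.2 • S.φ₁

lemma comb_apply (v : ℂ × ℂ) (x : ℝ) : S.comb v x = v.1 * S.θ x + v.2 * S.φ x := rfl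

lemma comb₁_apply (v : ℂ × ℂ) (x : ℝ) : S.comb₁ v x = v.1 * S.θ₁ x + v.2 * S.φ₁ x := rfl

lemma sol_comb (v : ℂ × ℂ) : τ.IsSolPair z (S.comb v) (S.comb₁ v) :=
  (S.sol_θ.smul v.1).add (S.sol_φ.smul v.2)

lemma eq_wronskian (f f₁ : ℝ → ℂ) {x : ℝ} (hx : x ∈ τ.I) :
    f x = wronskian f f₁ S.φ S.φ₁ x * S.θ x - wronskian f f₁ S.θ S.θ₁ x * S.φ x := by
  have := S.wronskian_eq_one hx
  simp only [wronskian]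
  linear_combination (-f x) * this

lemma eq_comb {u u₁ : ℝ → ℂ} (hu : τ.IsSolPair z u u₁) {x : ℝ} (hx : x ∈ τ.I) :
    u x = S.comb (u c, u₁ c) x := by
  rw [S.eq_wronskian u u₁ hx, S.sol_φ.wronskian_const hu S.mem hx,
    S.sol_θ.wronskian_const hu S.mem hx, comb_apply]
  simp [wronskian, S.θ_c, S.θ₁_c, S.φ_c, S.φ₁_c]

lemma eq_zero_of_comb_eq_zero {v : ℂ × ℂ} {x : ℝ} (hx : x ∈ τ.I) (h : S.comb v x = 0)
    (h₁ : S.comb₁ v x = 0) : v = 0 := by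
  have hw := S.wronskian_eq_one hx
  rw [comb_apply] at h
  rw [comb₁_apply] at h₁
  refine Prod.ext ?_ ?_
  · change v.1 = 0
    linear_combination (-v.1) * hw + S.φ₁ x * h - S.φ x * h₁
  · change v.2 = 0
    linear_combination (-v.2) * hw - S.θ₁ x * h + S.θ x * h₁

end FundamentalSystem

/-- A function in the domain of `τ` that vanishes on an open set has vanishing quasi-derivative
there. -/
lemma IsQuasiDeriv.eqOn_zero {f f₁ : ℝ → ℂ} (hf : τ.IsQuasiDeriv f f₁) {U : Set ℝ}
    (hU : IsOpen U) (hUI : U ⊆ τ.I) (h : ∀ᵐ x ∂(volume.restrict U), f x = 0) :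
    EqOn f 0 U ∧ EqOn f₁ 0 U := by
  have h0 : EqOn f 0 U := Measure.eqOn_open_of_ae_eq (μ := volume) h hU
    (hf.ac.continuousOn.mono hUI) continuousOn_const
  refine ⟨h0, Measure.eqOn_open_of_ae_eq (μ := volume) ?_ hU
    (hf.ac₁.continuousOn.mono hUI) continuousOn_const⟩
  filter_upwards [ae_mono (Measure.restrict_mono hUI le_rfl) hf.eq,
    ae_restrict_mem hU.measurableSet] with x hx hxU
  rw [hx, (h0.eventuallyEq_of_mem (hU.mem_nhds hxU)).deriv_eq, h0 hxU]
  simp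

lemma FundamentalSystem.eq_zero_of_ae_eq_zero {z : ℂ} {c : ℝ} (S : τ.FundamentalSystem z c)
    {v : ℂ × ℂ} {U : Set ℝ} (hU : IsOpen U) (hUI : U ⊆ τ.I) (hne : U.Nonempty)
    (h : ∀ᵐ x ∂(volume.restrict U), S.comb v x = 0) : v = 0 := by
  obtain ⟨h0, h1⟩ := (S.sol_comb v).qd.eqOn_zero hU hUI h
  obtain ⟨x, hx⟩ := hne
  exact S.eq_zero_of_comb_eq_zero (hUI hx) (h0 hx) (h1 hx)

end SturmLiouville

namespace SturmLiouville

variable {τ : SturmLiouville}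

/-! ### The measure `r(x) dx` -/

lemma aemeasurable_ofReal_r (τ : SturmLiouville) :
    AEMeasurable (fun x => ENNReal.ofReal (τ.r x)) (volume.restrict τ.I) :=
  (τ.locInt_r.aestronglyMeasurable).aemeasurable.ennreal_ofReal

lemma ae_r_pos (τ : SturmLiouville) : ∀ᵐ x ∂(volume.restrict τ.I), 0 < τ.r x := τ.r_pos

lemma ae_restrict_of_subset {J : Set ℝ} (hJI : J ⊆ τ.I) {P : ℝ → Prop}
    (h : ∀ᵐ x ∂(volume.restrict τ.I), P x) : ∀ᵐ x ∂(volume.restrict J), P x :=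
  ae_mono (Measure.restrict_mono hJI le_rfl) h

lemma absolutelyContinuous_μ (τ : SturmLiouville) : volume.restrict τ.I ≪ τ.μ := by
  intro s hs
  have h : ∀ᵐ x ∂τ.μ, x ∉ s := by simpa [ae_iff] using hs
  have h' := τ.ae_μ_iff.1 h
  simpa [ae_iff] using h'

lemma restrict_μ {J : Set ℝ} (hJ : MeasurableSet J) (hJI : J ⊆ τ.I) :
    τ.μ.restrict J = (volume.restrict J).withDensity (fun x => ENNReal.ofReal (τ.r x)) := by
  rw [μ, restrict_withDensity hJ, Measure.restrict_restrict hJ, inter_eq_left.2 hJI]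

lemma integral_μ (τ : SturmLiouville) (g : ℝ → ℂ) :
    ∫ x, g x ∂τ.μ = ∫ x in τ.I, (τ.r x : ℂ) * g x := by
  rw [μ, integral_withDensity_eq_integral_toReal_smul₀ τ.aemeasurable_ofReal_r (by simp)]
  refine integral_congr_ae ?_
  filter_upwards [τ.ae_r_pos] with x hx
  rw [ENNReal.toReal_ofReal hx.le, Complex.real_smul]

lemma memLp_two_iff_integrableOn {J : Set ℝ} (hJ : MeasurableSet J) (hJI : J ⊆ τ.I) {f : ℝ → ℂ}
    (hf : AEStronglyMeasurable f (volume.restrict J)) :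
    MemLp f 2 (τ.μ.restrict J) ↔ IntegrableOn (fun x => τ.r x * ‖f x‖ ^ 2) J volume := by
  rw [restrict_μ hJ hJI, memLp_two_iff_integrable_sq_norm
    (hf.mono_ac (withDensity_absolutelyContinuous _ _)),
    integrable_withDensity_iff_integrable_smul₀'
    (τ.aemeasurable_ofReal_r.mono_measure (Measure.restrict_mono hJI le_rfl)) (by simp)]
  refine integrable_congr ?_
  filter_upwards [ae_restrict_of_subset hJI τ.ae_r_pos] with x hx
  rw [ENNReal.toReal_ofReal hx.le, smul_eq_mul]

lemma memLp_restrict_I {f : ℝ → ℂ} : MemLp f 2 (τ.μ.restrict τ.I) ↔ MemLp f 2 τ.μ := by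
  rw [restrict_μ τ.measurableSet_I subset_rfl, μ]

lemma locallyIntegrableOn_r_mul {h : ℝ → ℂ} (hh : MemLp h 2 τ.μ) :
    LocallyIntegrableOn (fun x => (τ.r x : ℂ) * h x) τ.I volume := by
  have hm : AEStronglyMeasurable h (volume.restrict τ.I) :=
    hh.1.mono_ac τ.absolutelyContinuous_μ
  have h2 : IntegrableOn (fun x => τ.r x * ‖h x‖ ^ 2) τ.I volume :=
    (memLp_two_iff_integrableOn τ.measurableSet_I subset_rfl hm).1 (memLp_restrict_I.2 hh)
  have h3 : LocallyIntegrableOn (fun x => τ.r x + τ.r x * ‖h x‖ ^ 2) τ.I volume :=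
    τ.locInt_r.add h2.locallyIntegrableOn
  rw [locallyIntegrableOn_iff τ.isOpen_I.isLocallyClosed] at h3 ⊢
  intro K hKI hK
  refine (h3 K hKI hK).mono' ?_ ?_
  · exact ((Complex.continuous_ofReal.comp_aestronglyMeasurable
      τ.locInt_r.aestronglyMeasurable).mul hm).mono_measure (Measure.restrict_mono hKI le_rfl)
  · filter_upwards [ae_restrict_of_subset hKI τ.ae_r_pos] with x hx
    rw [norm_mul, Complex.norm_real, Real.norm_of_nonneg hx.le]
    nlinarith [mul_nonneg hx.le (sq_nonneg (‖h x‖ - 1)), mul_nonneg hx.le (sq_nonneg (‖h x‖ + 1)),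
      mul_nonneg hx.le (sq_nonneg (‖h x‖))]

lemma locallyIntegrableOn_r_mul_continuousOn {N : ℝ → ℝ} (hN : ContinuousOn N τ.I) :
    LocallyIntegrableOn (fun x => τ.r x * N x) τ.I volume := by
  have h := (locallyIntegrableOn_iff τ.isOpen_I.isLocallyClosed).1 τ.locInt_r
  rw [locallyIntegrableOn_iff τ.isOpen_I.isLocallyClosed]
  exact fun K hKI hK => (h K hKI hK).mul_continuousOn (hN.mono hKI) hK

lemma locallyIntegrableOn_r_mul_norm_sq {f : ℝ → ℂ} (hf : ContinuousOn f τ.I) :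
    LocallyIntegrableOn (fun x => τ.r x * ‖f x‖ ^ 2) τ.I volume :=
  locallyIntegrableOn_r_mul_continuousOn (hf.norm.pow 2)

lemma ae_r_mul_norm_sq_nonneg (τ : SturmLiouville) (f : ℝ → ℂ) :
    ∀ᵐ x ∂(volume.restrict τ.I), 0 ≤ τ.r x * ‖f x‖ ^ 2 := by
  filter_upwards [τ.ae_r_pos] with x hx using by positivity

lemma memLp_restrict_of_isCompact {f : ℝ → ℂ} (hf : ContinuousOn f τ.I) {K : Set ℝ}
    (hK : IsCompact K) (hKI : K ⊆ τ.I) : MemLp f 2 (τ.μ.restrict K) := by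
  rw [memLp_two_iff_integrableOn hK.measurableSet hKI
    ((hf.mono hKI).aestronglyMeasurable hK.measurableSet)]
  exact (locallyIntegrableOn_iff τ.isOpen_I.isLocallyClosed).1
    (locallyIntegrableOn_r_mul_norm_sq hf) K hKI hK

/-! ### The two sides of a point -/

/-- The part of `(a, b)` to the right (`true`) or to the left (`false`) of `c`, with `c`. -/
def side (τ : SturmLiouville) (c : ℝ) : Bool → Set ℝ
  | true => τ.I ∩ Ici c
  | false => τ.I ∩ Iic c

lemma side_subset (τ : SturmLiouville) (c : ℝ) : ∀ b, τ.side c b ⊆ τ.I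
  | true => inter_subset_left
  | false => inter_subset_left

lemma measurableSet_side (τ : SturmLiouville) (c : ℝ) : ∀ b, MeasurableSet (τ.side c b)
  | true => τ.measurableSet_I.inter measurableSet_Ici
  | false => τ.measurableSet_I.inter measurableSet_Iic

lemma mem_side {c : ℝ} (hc : c ∈ τ.I) : ∀ b, c ∈ τ.side c b
  | true => ⟨hc, mem_Ici.2 le_rfl⟩
  | false => ⟨hc, mem_Iic.2 le_rfl⟩

lemma uIcc_subset_side {c : ℝ} (hc : c ∈ τ.I) {b : Bool} {x : ℝ} (hx : x ∈ τ.side c b) :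
    uIcc c x ⊆ τ.side c b := by
  have h := τ.ordConnected_I.uIcc_subset hc (τ.side_subset c b hx)
  cases b
  · have hxc : x ≤ c := hx.2
    rw [uIcc_of_ge hxc] at h ⊢
    exact fun t ht => ⟨h ht, ht.2⟩
  · have hxc : c ≤ x := hx.2
    rw [uIcc_of_le hxc] at h ⊢
    exact fun t ht => ⟨h ht, ht.1⟩

/-- A rational number of the side beyond a given point. -/
lemma exists_rat_side {c : ℝ} {b : Bool} {x : ℝ} (hx : x ∈ τ.side c b) :
    ∃ q : ℚ, (q : ℝ) ∈ τ.side c b ∧ x ∈ uIcc c (q : ℝ) := by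
  obtain ⟨ε, hε, hb⟩ := Metric.isOpen_iff.1 τ.isOpen_I x (τ.side_subset c b hx)
  cases b
  · obtain ⟨q, h1, h2⟩ := exists_rat_btwn (show x - ε < x by linarith)
    have hxc : x ≤ c := hx.2
    refine ⟨q, ⟨hb ?_, (h2.trans_le hxc).le⟩, ?_⟩
    · rw [Metric.mem_ball, Real.dist_eq, abs_lt]; constructor <;> linarith
    · rw [uIcc_of_ge (by linarith)]; exact ⟨h2.le, hxc⟩
  · obtain ⟨q, h1, h2⟩ := exists_rat_btwn (show x < x + ε by linarith)
    have hxc : c ≤ x := hx.2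
    refine ⟨q, ⟨hb ?_, (hxc.trans_lt h1).le⟩, ?_⟩
    · rw [Metric.mem_ball, Real.dist_eq, abs_lt]; constructor <;> linarith
    · rw [uIcc_of_le (by linarith)]; exact ⟨hxc, h1.le⟩

lemma uIcc_subset_or {c : ℝ} {b : Bool} {x y : ℝ} (hx : x ∈ τ.side c b)
    (hy : y ∈ τ.side c b) : uIcc c x ⊆ uIcc c y ∨ uIcc c y ⊆ uIcc c x := by
  cases b
  · have hxc : x ≤ c := hx.2
    have hyc : y ≤ c := hy.2
    rw [uIcc_of_ge hxc, uIcc_of_ge hyc]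
    exact (le_total y x).imp (fun h => Icc_subset_Icc_left h) fun h => Icc_subset_Icc_left h
  · have hxc : c ≤ x := hx.2
    have hyc : c ≤ y := hy.2
    rw [uIcc_of_le hxc, uIcc_of_le hyc]
    exact (le_total x y).imp (fun h => Icc_subset_Icc_right h) fun h => Icc_subset_Icc_right h

lemma abs_integral_eq_setIntegral {g : ℝ → ℝ} (hg0 : ∀ᵐ x ∂(volume.restrict τ.I), 0 ≤ g x)
    {x y : ℝ} (hx : x ∈ τ.I) (hy : y ∈ τ.I) : |∫ t in x..y, g t| = ∫ t in uIoc x y, g t := by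
  rw [← Real.norm_eq_abs, intervalIntegral.norm_integral_eq_norm_integral_uIoc,
    Real.norm_of_nonneg]
  exact integral_nonneg_of_ae (ae_restrict_of_subset
    (uIoc_subset_uIcc.trans (τ.ordConnected_I.uIcc_subset hx hy)) hg0)

lemma integrableOn_side_of_bounded {g : ℝ → ℝ} (hg : LocallyIntegrableOn g τ.I volume)
    (hg0 : ∀ᵐ x ∂(volume.restrict τ.I), 0 ≤ g x) {c M : ℝ} (hc : c ∈ τ.I) {b : Bool}
    (hM : ∀ x ∈ τ.side c b, |∫ t in c..x, g t| ≤ M) : IntegrableOn g (τ.side c b) volume := by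
  refine ⟨hg.aestronglyMeasurable.mono_measure
    (Measure.restrict_mono (τ.side_subset c b) le_rfl), ?_⟩
  rw [hasFiniteIntegral_iff_enorm]
  let Q := {q : ℚ // (q : ℝ) ∈ τ.side c b}
  have hU : τ.side c b = ⋃ q : Q, uIcc c ((q : ℚ) : ℝ) := by
    refine Subset.antisymm (fun x hx => ?_) (iUnion_subset fun q => uIcc_subset_side hc q.2)
    obtain ⟨q, hq, hxq⟩ := exists_rat_side hx
    exact mem_iUnion.2 ⟨⟨q, hq⟩, hxq⟩
  have hd : Directed (· ⊆ ·) (fun q : Q => uIcc c ((q : ℚ) : ℝ)) := fun p q => by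
    rcases uIcc_subset_or p.2 q.2 with h | h
    · exact ⟨q, h, subset_rfl⟩
    · exact ⟨p, subset_rfl, h⟩
  rw [← withDensity_apply' (fun x => ‖g x‖ₑ), hU, hd.measure_iUnion]
  refine (iSup_le fun q => ?_ : _ ≤ ENNReal.ofReal M).trans_lt ENNReal.ofReal_lt_top
  have hqI := τ.side_subset c b q.2
  have hi : IntegrableOn g (uIcc c ((q : ℚ) : ℝ)) volume := hg.integrableOn_compact_subset
    (τ.ordConnected_I.uIcc_subset hc hqI) isCompact_uIcc
  rw [withDensity_apply' _, ← ofReal_integral_norm_eq_lintegral_enorm hi]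
  refine ENNReal.ofReal_le_ofReal (le_trans (le_of_eq ?_) (hM q q.2))
  rw [abs_integral_eq_setIntegral hg0 hc hqI]
  have h1 : ∫ t in uIcc c ((q : ℚ) : ℝ), ‖g t‖ = ∫ t in uIcc c ((q : ℚ) : ℝ), g t := by
    refine integral_congr_ae ?_
    filter_upwards [ae_restrict_of_subset (τ.ordConnected_I.uIcc_subset hc hqI) hg0] with x hx
    exact Real.norm_of_nonneg hx
  rw [h1, uIcc, uIoc, integral_Icc_eq_integral_Ioc]

lemma abs_integral_le_of_integrableOn_side {g : ℝ → ℝ}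
    (hg0 : ∀ᵐ x ∂(volume.restrict τ.I), 0 ≤ g x) {c : ℝ} (hc : c ∈ τ.I) {b : Bool}
    (hg : IntegrableOn g (τ.side c b) volume) {x : ℝ} (hx : x ∈ τ.side c b) :
    |∫ t in c..x, g t| ≤ ∫ t in τ.side c b, g t := by
  rw [abs_integral_eq_setIntegral hg0 hc (τ.side_subset c b hx)]
  exact setIntegral_mono_set hg (ae_restrict_of_subset (τ.side_subset c b) hg0)
    (uIoc_subset_uIcc.trans (uIcc_subset_side hc hx)).eventuallyLE

/-- `f` lies in `L²` on the given side of `c`. -/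
def L2Side (τ : SturmLiouville) (c : ℝ) (b : Bool) (f : ℝ → ℂ) : Prop :=
  MemLp f 2 (τ.μ.restrict (τ.side c b))

lemma l2Side_iff {f : ℝ → ℂ} (hf : ContinuousOn f τ.I) {c : ℝ} {b : Bool} :
    τ.L2Side c b f ↔ IntegrableOn (fun x => τ.r x * ‖f x‖ ^ 2) (τ.side c b) volume :=
  memLp_two_iff_integrableOn (τ.measurableSet_side c b) (τ.side_subset c b)
    ((hf.mono (τ.side_subset c b)).aestronglyMeasurable (τ.measurableSet_side c b))

lemma memLp_of_subset_union {f : ℝ → ℂ} (hf : ContinuousOn f τ.I) {J J₁ J₂ : Set ℝ}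
    (hJ₁m : MeasurableSet J₁) (hJ₂m : MeasurableSet J₂)
    (hJ₁ : J₁ ⊆ τ.I) (hJ₂ : J₂ ⊆ τ.I) (hJ : J ∩ τ.I ⊆ J₁ ∪ J₂)
    (h₁ : MemLp f 2 (τ.μ.restrict J₁)) (h₂ : MemLp f 2 (τ.μ.restrict J₂)) :
    MemLp f 2 (τ.μ.restrict J) := by
  have hU : J₁ ∪ J₂ ⊆ τ.I := union_subset hJ₁ hJ₂
  rw [memLp_two_iff_integrableOn hJ₁m hJ₁ ((hf.mono hJ₁).aestronglyMeasurable hJ₁m)] at h₁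
  rw [memLp_two_iff_integrableOn hJ₂m hJ₂ ((hf.mono hJ₂).aestronglyMeasurable hJ₂m)] at h₂
  have h := (memLp_two_iff_integrableOn (hJ₁m.union hJ₂m) hU
    ((hf.mono hU).aestronglyMeasurable (hJ₁m.union hJ₂m))).2 (h₁.union h₂)
  refine h.mono_measure ?_
  have hμ : τ.μ.restrict τ.I = τ.μ := by rw [restrict_μ τ.measurableSet_I subset_rfl, μ]
  rw [← hμ, Measure.restrict_restrict' τ.measurableSet_I, hμ]
  exact Measure.restrict_mono hJ le_rfl

lemma l2NearA_iff {f : ℝ → ℂ} (hf : ContinuousOn f τ.I) {c : ℝ} (hc : c ∈ τ.I) :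
    τ.L2NearA f ↔ τ.L2Side c false f := by
  constructor
  · intro h
    obtain ⟨ε, hε, hb⟩ := Metric.isOpen_iff.1 τ.isOpen_I c hc
    refine (h (c + ε / 2) (hb (by simp [abs_of_pos hε]; linarith))).mono_measure
      (Measure.restrict_mono (fun x hx => ?_) le_rfl)
    have hxc : x ≤ c := hx.2
    exact mem_Iio.2 (by linarith)
  · intro h e he
    refine memLp_of_subset_union hf (τ.measurableSet_side c false) measurableSet_uIcc
      (τ.side_subset c false) (τ.ordConnected_I.uIcc_subset hc he) (fun x hx => ?_) h
      (memLp_restrict_of_isCompact hf isCompact_uIcc (τ.ordConnected_I.uIcc_subset hc he))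
    rcases le_total x c with hxc | hxc
    · exact Or.inl ⟨hx.2, hxc⟩
    · exact Or.inr (Icc_subset_uIcc ⟨hxc, (mem_Iio.1 hx.1).le⟩)

lemma l2NearB_iff {f : ℝ → ℂ} (hf : ContinuousOn f τ.I) {c : ℝ} (hc : c ∈ τ.I) :
    τ.L2NearB f ↔ τ.L2Side c true f := by
  constructor
  · intro h
    obtain ⟨ε, hε, hb⟩ := Metric.isOpen_iff.1 τ.isOpen_I c hc
    refine (h (c - ε / 2) (hb (by simp [abs_of_pos hε]; linarith))).mono_measure
      (Measure.restrict_mono (fun x hx => ?_) le_rfl)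
    have hxc : c ≤ x := hx.2
    exact mem_Ioi.2 (by linarith)
  · intro h e he
    refine memLp_of_subset_union hf (τ.measurableSet_side c true) measurableSet_uIcc
      (τ.side_subset c true) (τ.ordConnected_I.uIcc_subset he hc) (fun x hx => ?_) h
      (memLp_restrict_of_isCompact hf isCompact_uIcc (τ.ordConnected_I.uIcc_subset he hc))
    rcases le_total c x with hxc | hxc
    · exact Or.inl ⟨hx.2, hxc⟩
    · exact Or.inr (Icc_subset_uIcc ⟨(mem_Ioi.1 hx.1).le, hxc⟩)

lemma memLp_iff_l2Side {f : ℝ → ℂ} (hf : ContinuousOn f τ.I) (c : ℝ) :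
    MemLp f 2 τ.μ ↔ τ.L2Side c false f ∧ τ.L2Side c true f := by
  refine ⟨fun h => ⟨h.restrict _, h.restrict _⟩, fun ⟨h₁, h₂⟩ => memLp_restrict_I.1 ?_⟩
  refine memLp_of_subset_union hf (τ.measurableSet_side c false) (τ.measurableSet_side c true)
    (τ.side_subset c false) (τ.side_subset c true) (fun x hx => ?_) h₁ h₂
  exact (le_total x c).imp (fun h => ⟨hx.1, h⟩) fun h => ⟨hx.1, h⟩

end SturmLiouville

namespace SturmLiouville

variable {τ : SturmLiouville}

/-! ### Weyl's alternative -/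

lemma continuousOn_wronskian {f f₁ g g₁ : ℝ → ℂ} (hf : τ.IsQuasiDeriv f f₁)
    (hg : τ.IsQuasiDeriv g g₁) : ContinuousOn (wronskian f f₁ g g₁) τ.I :=
  (hf.ac.continuousOn.mul hg.ac₁.continuousOn).sub (hf.ac₁.continuousOn.mul hg.ac.continuousOn)

/-- If the solutions for one spectral parameter lie in `L²` on one side, then so do those for every
other spectral parameter. -/
theorem FundamentalSystem.l2Side_of_l2Side {z z' : ℂ} {c : ℝ} (S : τ.FundamentalSystem z c)
    {b : Bool} (hθ : τ.L2Side c b S.θ) (hφ : τ.L2Side c b S.φ) {u u₁ : ℝ → ℂ}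
    (hu : τ.IsSolPair z' u u₁) : τ.L2Side c b u := by
  have hθc := S.sol_θ.qd.ac.continuousOn
  have hφc := S.sol_φ.qd.ac.continuousOn
  have huc := hu.qd.ac.continuousOn
  set m : ℝ → ℝ := fun x => ‖S.θ x‖ + ‖S.φ x‖ with hm
  have hm0 : ∀ x, 0 ≤ m x := fun x => by positivity
  have hmc : ContinuousOn m τ.I := hθc.norm.add hφc.norm
  have hmL : τ.L2Side c b (fun x => (m x : ℂ)) := (hθ.norm.add hφ.norm).ofReal
  have hmi : IntegrableOn (fun x => τ.r x * m x ^ 2) (τ.side c b) volume := by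
    have := (l2Side_iff (Complex.continuous_ofReal.comp_continuousOn hmc)).1 hmL
    simpa [abs_of_nonneg (hm0 _)] using this
  set C₁ := wronskian u u₁ S.φ S.φ₁
  set C₂ := wronskian u u₁ S.θ S.θ₁
  set N : ℝ → ℝ := fun x => ‖C₁ x‖ + ‖C₂ x‖ with hN
  have hNc : ContinuousOn N τ.I := (continuousOn_wronskian hu.qd S.sol_φ.qd).norm.add
    (continuousOn_wronskian hu.qd S.sol_θ.qd).norm
  have hN0 : ∀ x, 0 ≤ N x := fun x => by positivity
  have hule : ∀ x ∈ τ.I, ‖u x‖ ≤ N x * m x := fun x hx => by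
    rw [S.eq_wronskian u u₁ hx]
    refine (norm_sub_le _ _).trans ?_
    rw [norm_mul, norm_mul, hN, hm]
    nlinarith [norm_nonneg (C₁ x), norm_nonneg (C₂ x), norm_nonneg (S.θ x), norm_nonneg (S.φ x),
      mul_nonneg (norm_nonneg (C₁ x)) (norm_nonneg (S.φ x)),
      mul_nonneg (norm_nonneg (C₂ x)) (norm_nonneg (S.θ x))]
  set k : ℝ → ℝ := fun x => ‖z' - z‖ * (|τ.r x| * m x ^ 2) with hk
  have hk0 : ∀ x, 0 ≤ k x := fun x => by positivity
  have hrabs : ∀ᵐ x ∂(volume.restrict τ.I), |τ.r x| = τ.r x := by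
    filter_upwards [τ.ae_r_pos] with x hx using abs_of_pos hx
  have hkI : IntegrableOn k (τ.side c b) volume := by
    refine Integrable.const_mul (hmi.congr ?_) _
    filter_upwards [ae_restrict_of_subset (τ.side_subset c b) hrabs] with x hx
    rw [hx]
  have hkloc : LocallyIntegrableOn k τ.I volume := by
    have h1 : LocallyIntegrableOn (fun x => τ.r x * (‖z' - z‖ * m x ^ 2)) τ.I volume :=
      locallyIntegrableOn_r_mul_continuousOn ((hmc.pow 2).const_mul _)
    have h2 := h1.norm
    convert h2 using 2 with x
    rw [norm_mul, Real.norm_eq_abs, Real.norm_of_nonneg (by positivity), hk]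
    ring
  have hbound : ∀ t ∈ τ.I, N t ≤ N c + |∫ x in c..t, k x * N x| := by
    intro t ht
    have hh : ∀ᵐ x ∂(volume.restrict τ.I), τ.expr u u₁ x = z * u x + (z' - z) * u x := by
      filter_upwards [hu.eq] with x hx
      rw [hx]; ring
    have e₁ := S.sol_φ.wronskian_sub hu.qd hh S.mem ht
    have e₂ := S.sol_θ.wronskian_sub hu.qd hh S.mem ht
    have hsub := τ.ordConnected_I.uIcc_subset S.mem ht
    have hi : ∀ {w : ℝ → ℂ}, ContinuousOn w τ.I → IntegrableOn
        (fun x => ‖(τ.r x : ℂ) * ((z' - z) * u x * w x)‖) (uIoc c t) volume := by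
      intro w hw
      have h1 := (locallyIntegrableOn_r_mul_continuousOn (τ := τ)
        ((huc.norm.mul hw.norm).const_mul ‖z' - z‖)).norm.intervalIntegrable
          τ.ordConnected_I S.mem ht
      refine (intervalIntegrable_iff.1 h1).congr_fun (fun x _ => ?_) measurableSet_uIoc
      simp only [norm_mul, Complex.norm_real, norm_norm, Pi.mul_apply]
      ring
    have hle : ∀ {w : ℝ → ℂ} {C : ℂ}, C = ∫ x in c..t, (τ.r x : ℂ) * ((z' - z) * u x * w x) →
        ‖C‖ ≤ ∫ x in uIoc c t, ‖(τ.r x : ℂ) * ((z' - z) * u x * w x)‖ := by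
      rintro w C rfl
      rw [intervalIntegral.norm_integral_eq_norm_integral_uIoc]
      exact norm_integral_le_integral_norm _
    have h3 : N t ≤ N c + (‖C₁ t - C₁ c‖ + ‖C₂ t - C₂ c‖) := by
      have := norm_le_norm_add_norm_sub' (C₁ t) (C₁ c)
      have := norm_le_norm_add_norm_sub' (C₂ t) (C₂ c)
      simp only [hN]
      linarith
    refine h3.trans (add_le_add_right ((add_le_add (hle e₁) (hle e₂)).trans ?_) _)
    rw [abs_integral_of_nonneg (fun x => mul_nonneg (hk0 x) (hN0 x)),
      ← integral_add (hi hφc) (hi hθc)]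
    refine setIntegral_mono_on ((hi hφc).add (hi hθc)) (intervalIntegrable_iff.1
      ((hkloc.intervalIntegrable τ.ordConnected_I S.mem ht).mul_continuousOn
        (hNc.mono hsub))) measurableSet_uIoc fun x hx => ?_
    have h4 := hule x (hsub (uIoc_subset_uIcc hx))
    simp only [norm_mul, Complex.norm_real, Real.norm_eq_abs]
    calc |τ.r x| * (‖z' - z‖ * ‖u x‖ * ‖S.φ x‖) + |τ.r x| * (‖z' - z‖ * ‖u x‖ * ‖S.θ x‖)
        = (|τ.r x| * ‖z' - z‖ * m x) * ‖u x‖ := by rw [hm]; ring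
      _ ≤ (|τ.r x| * ‖z' - z‖ * m x) * (N x * m x) :=
        mul_le_mul_of_nonneg_left h4 (mul_nonneg (by positivity) (hm0 x))
      _ = k x * N x := by rw [hk]; ring
  set B := 2 * N c * Real.exp (2 * ∫ t in τ.side c b, k t) with hB
  have hNB : ∀ x ∈ τ.side c b, N x ≤ B := fun x hx => by
    have hxI := τ.side_subset c b hx
    refine (gronwall_of_locallyIntegrableOn τ.ordConnected_I τ.isOpen_I S.mem hkloc hk0 hNc hN0
      (hN0 c) hxI fun t ht => hbound t (τ.ordConnected_I.uIcc_subset S.mem hxI ht)).trans ?_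
    refine mul_le_mul_of_nonneg_left (Real.exp_le_exp.2 ?_) (by linarith [hN0 c])
    have := abs_integral_le_of_integrableOn_side (Eventually.of_forall hk0) S.mem hkI hx
    linarith
  refine MemLp.of_le_mul (c := B) hmL ?_ ?_
  · rw [restrict_μ (τ.measurableSet_side c b) (τ.side_subset c b)]
    exact ((huc.mono (τ.side_subset c b)).aestronglyMeasurable
      (τ.measurableSet_side c b)).mono_ac (withDensity_absolutelyContinuous _ _)
  · filter_upwards [ae_restrict_mem (τ.measurableSet_side c b)] with x hx
    rw [Complex.norm_real, Real.norm_of_nonneg (hm0 x)]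
    exact (hule x (τ.side_subset c b hx)).trans
      (mul_le_mul_of_nonneg_right (hNB x hx) (hm0 x))

namespace FundamentalSystem

variable {z : ℂ} {c : ℝ} (S : τ.FundamentalSystem z c)

lemma continuousOn_comb (v : ℂ × ℂ) : ContinuousOn (S.comb v) τ.I :=
  (S.sol_comb v).qd.ac.continuousOn

/-- The initial values at `c` of the solutions that lie in `L²` on the given side of `c`. -/
def l2Space (b : Bool) : Submodule ℂ (ℂ × ℂ) where
  carrier := {v | τ.L2Side c b (S.comb v)}
  zero_mem' := by
    have : S.comb 0 = 0 := by ext x; simp [comb_apply]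
    rw [mem_ofPred_eq, this]
    exact MemLp.zero
  add_mem' := fun {v w} hv hw => by
    have : S.comb (v + w) = S.comb v + S.comb w := by ext x; simp [comb_apply]; ring
    rw [mem_ofPred_eq, this]
    exact hv.add hw
  smul_mem' := fun t v hv => by
    have : S.comb (t • v) = t • S.comb v := by ext x; simp [comb_apply]; ring
    rw [mem_ofPred_eq, this]
    exact hv.const_smul t

lemma mem_l2Space {b : Bool} {v : ℂ × ℂ} : v ∈ S.l2Space b ↔ τ.L2Side c b (S.comb v) := Iff.rfl

lemma forall_l2Side_iff {b : Bool} :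
    (∀ z' u u₁, τ.IsSolPair z' u u₁ → τ.L2Side c b u) ↔ S.l2Space b = ⊤ := by
  refine ⟨fun h => eq_top_iff.2 fun v _ => h z _ _ (S.sol_comb v), fun h z' u u₁ hu => ?_⟩
  have h1 : (1, 0) ∈ S.l2Space b := h ▸ Submodule.mem_top
  have h2 : (0, 1) ∈ S.l2Space b := h ▸ Submodule.mem_top
  refine S.l2Side_of_l2Side ?_ ?_ hu
  · have e : S.comb (1, 0) = S.θ := by ext x; simp [comb_apply]
    exact e ▸ S.mem_l2Space.1 h1
  · have e : S.comb (0, 1) = S.φ := by ext x; simp [comb_apply]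
    exact e ▸ S.mem_l2Space.1 h2

lemma limitCircleA_iff : τ.LimitCircleA ↔ S.l2Space false = ⊤ := by
  rw [← S.forall_l2Side_iff]
  constructor
  · intro h z' u u₁ hu
    exact (l2NearA_iff hu.qd.ac.continuousOn S.mem).1 (h z' u (isSolution_iff.2 ⟨u₁, hu⟩))
  · intro h z' u hu
    obtain ⟨u₁, hu⟩ := isSolution_iff.1 hu
    exact (l2NearA_iff hu.qd.ac.continuousOn S.mem).2 (h z' u u₁ hu)

lemma limitCircleB_iff : τ.LimitCircleB ↔ S.l2Space true = ⊤ := by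
  rw [← S.forall_l2Side_iff]
  constructor
  · intro h z' u u₁ hu
    exact (l2NearB_iff hu.qd.ac.continuousOn S.mem).1 (h z' u (isSolution_iff.2 ⟨u₁, hu⟩))
  · intro h z' u hu
    obtain ⟨u₁, hu⟩ := isSolution_iff.1 hu
    exact (l2NearB_iff hu.qd.ac.continuousOn S.mem).2 (h z' u u₁ hu)

end FundamentalSystem

theorem limitPointA_iff (τ : SturmLiouville) : τ.LimitPointA ↔ ¬ τ.LimitCircleA := by
  constructor
  · intro h h'
    obtain ⟨u, hu, hn⟩ := h 0
    exact hn (h' 0 u hu)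
  · intro h z
    obtain ⟨c, hc⟩ := τ.nonempty_I
    obtain ⟨S⟩ := nonempty_fundamentalSystem z hc
    rw [S.limitCircleA_iff, Submodule.eq_top_iff'] at h
    push Not at h
    obtain ⟨v, hv⟩ := h
    exact ⟨S.comb v, isSolution_iff.2 ⟨_, S.sol_comb v⟩, fun h' =>
      hv ((l2NearA_iff (S.continuousOn_comb v) hc).1 h')⟩

theorem limitPointB_iff (τ : SturmLiouville) : τ.LimitPointB ↔ ¬ τ.LimitCircleB := by
  constructor
  · intro h h'
    obtain ⟨u, hu, hn⟩ := h 0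
    exact hn (h' 0 u hu)
  · intro h z
    obtain ⟨c, hc⟩ := τ.nonempty_I
    obtain ⟨S⟩ := nonempty_fundamentalSystem z hc
    rw [S.limitCircleB_iff, Submodule.eq_top_iff'] at h
    push Not at h
    obtain ⟨v, hv⟩ := h
    exact ⟨S.comb v, isSolution_iff.2 ⟨_, S.sol_comb v⟩, fun h' =>
      hv ((l2NearB_iff (S.continuousOn_comb v) hc).1 h')⟩

/-! ### Square integrable solutions for nonreal spectral parameters -/

/-- The imaginary part of `u` times the conjugate of its quasi-derivative grows like the `L²`-norm
of the solution `u`. -/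
lemma IsSolPair.im_mul_conj_sub {z : ℂ} {u u₁ : ℝ → ℂ} (hu : τ.IsSolPair z u u₁) {x y : ℝ}
    (hx : x ∈ τ.I) (hy : y ∈ τ.I) :
    (u y * star (u₁ y)).im - (u x * star (u₁ x)).im =
      z.im * ∫ t in x..y, τ.r t * ‖u t‖ ^ 2 := by
  have h := (hu.conj.qd.lagrange hu.qd hx hy).2
  have h1 : ∫ t in x..y, (τ.r t : ℂ) * (τ.expr (fun x => star (u x)) (fun x => star (u₁ x)) t *
      u t - star (u t) * τ.expr u u₁ t) =
      ∫ t in x..y, (-2 * Complex.I * z.im) * ((τ.r t * ‖u t‖ ^ 2 : ℝ) : ℂ) := by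
    refine intervalIntegral.integral_congr_ae (uIoc_ae_of_ae_restrict ?_ hx hy)
    filter_upwards [hu.eq, hu.conj.eq] with t h1 h2
    rw [h1, h2]
    have e1 : star (u t) * u t = ((‖u t‖ ^ 2 : ℝ) : ℂ) := by
      rw [mul_comm]; simpa using Complex.mul_conj' (u t)
    have e2 : star z - z = -2 * Complex.I * z.im := by
      apply Complex.ext <;> simp
      ring
    push_cast at e1 ⊢
    linear_combination (τ.r t * (star z - z)) * e1 + τ.r t * (‖u t‖ : ℂ) ^ 2 * e2
  have h2 : ∀ t, wronskian (fun x => star (u x)) (fun x => star (u₁ x)) u u₁ t =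
      -2 * Complex.I * ((u t * star (u₁ t)).im : ℂ) := fun t => by
    apply Complex.ext <;> simp [wronskian] <;> ring
  rw [h1, h2, h2, intervalIntegral.integral_const_mul, intervalIntegral.integral_ofReal] at h
  have h3 := congrArg Complex.im h
  simp at h3
  simp
  linarith

namespace FundamentalSystem

variable {z : ℂ} {c : ℝ} (S : τ.FundamentalSystem z c)

/-- The Hermitian form `Im (u conj(u^[1]))(x)` on the space of solutions. -/
def form (v : ℂ × ℂ) (x : ℝ) : ℝ := (S.comb v x * star (S.comb₁ v x)).im

/-- The sign with which the form has to be multiplied to be increasing away from `c`. -/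
def outward (_S : τ.FundamentalSystem z c) : Bool → ℝ
  | true => z.im
  | false => -z.im

lemma outward_mul_form_sub (v : ℂ × ℂ) {b : Bool} {x : ℝ} (hx : x ∈ τ.side c b) :
    S.outward b * S.form v x - S.outward b * S.form v c =
      z.im ^ 2 * |∫ t in c..x, τ.r t * ‖S.comb v t‖ ^ 2| := by
  have h := (S.sol_comb v).im_mul_conj_sub S.mem (τ.side_subset c b hx)
  have h0 := τ.ae_r_mul_norm_sq_nonneg (S.comb v)
  have hs := abs_integral_eq_setIntegral h0 S.mem (τ.side_subset c b hx)
  rw [← mul_sub, form, form, h, hs]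
  cases b
  · have hxc : x ≤ c := hx.2
    rw [intervalIntegral.integral_of_ge hxc, uIoc_of_ge hxc, outward]
    ring
  · have hxc : c ≤ x := hx.2
    rw [intervalIntegral.integral_of_le hxc, uIoc_of_le hxc, outward]
    ring

lemma outward_mul_form_mono (v : ℂ × ℂ) {b : Bool} {x y : ℝ} (hx : x ∈ τ.side c b)
    (hy : y ∈ τ.side c b) (hxy : x ∈ uIcc c y) :
    S.outward b * S.form v x ≤ S.outward b * S.form v y := by
  have h1 := S.outward_mul_form_sub v hx
  have h2 := S.outward_mul_form_sub v hy
  have h0 := τ.ae_r_mul_norm_sq_nonneg (S.comb v)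
  have hI := τ.side_subset c b hy
  have hle : |∫ t in c..x, τ.r t * ‖S.comb v t‖ ^ 2| ≤
      |∫ t in c..y, τ.r t * ‖S.comb v t‖ ^ 2| := by
    rw [abs_integral_eq_setIntegral h0 S.mem (τ.side_subset c b hx),
      abs_integral_eq_setIntegral h0 S.mem hI]
    refine setIntegral_mono_set (intervalIntegrable_iff.1
      ((locallyIntegrableOn_r_mul_norm_sq (S.continuousOn_comb v)).intervalIntegrable
        τ.ordConnected_I S.mem hI)) (ae_restrict_of_subset
      (uIoc_subset_uIcc.trans (τ.ordConnected_I.uIcc_subset S.mem hI)) h0) ?_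
    have : uIoc c x ⊆ uIoc c y := by
      intro t ht
      rw [mem_uIcc] at hxy
      rw [mem_uIoc] at ht ⊢
      grind
    exact this.eventuallyLE
  nlinarith [mul_le_mul_of_nonneg_left hle (sq_nonneg z.im)]

lemma continuous_form (x : ℝ) : Continuous fun v => S.form v x := by
  simp only [form, comb_apply, comb₁_apply]
  fun_prop

lemma form_smul (t : ℂ) (v : ℂ × ℂ) (x : ℝ) : S.form (t • v) x = ‖t‖ ^ 2 * S.form v x := by
  have h1 : S.comb (t • v) x = t * S.comb v x := by simp [comb_apply]; ring
  have h2 : S.comb₁ (t • v) x = t * S.comb₁ v x := by simp [comb₁_apply]; ring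
  have h3 : t * star t = ((‖t‖ ^ 2 : ℝ) : ℂ) := by simpa using Complex.mul_conj' t
  have h4 : t * S.comb v x * star (t * S.comb₁ v x) =
      ((‖t‖ ^ 2 : ℝ) : ℂ) * (S.comb v x * star (S.comb₁ v x)) := by
    rw [star_mul', ← h3]; ring
  rw [form, h1, h2, h4, Complex.im_ofReal_mul, form]

/-- There is a solution whose form never becomes positive in the outward direction. -/
theorem exists_outward_form_nonpos (b : Bool) :
    ∃ v : ℂ × ℂ, v ≠ 0 ∧ ∀ x ∈ τ.side c b, S.outward b * S.form v x ≤ 0 := by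
  let K : τ.side c b → Set (ℂ × ℂ) := fun x =>
    Metric.sphere 0 1 ∩ {v | S.outward b * S.form v x ≤ 0}
  have hclosed : ∀ x, IsClosed (K x) := fun x =>
    Metric.isClosed_sphere.inter (isClosed_le ((S.continuous_form x).const_mul _)
      continuous_const)
  have hne : ∀ x, (K x).Nonempty := by
    rintro ⟨x, hx⟩
    have hw := S.wronskian_eq_one (τ.side_subset c b hx)
    let v : ℂ × ℂ := (S.φ₁ x, -S.θ₁ x)
    have h1 : S.comb v x = 1 := by simp only [v, comb_apply]; linear_combination hw
    have h2 : S.comb₁ v x = 0 := by simp only [v, comb₁_apply]; ring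
    have hv : v ≠ 0 := by
      intro hv
      rw [hv] at h1
      simp [comb_apply] at h1
    have hn : ‖v‖ ≠ 0 := norm_ne_zero_iff.2 hv
    refine ⟨((‖v‖⁻¹ : ℝ) : ℂ) • v, ?_, ?_⟩
    · rw [mem_sphere_zero_iff_norm, norm_smul, Complex.norm_real, norm_inv, norm_norm,
        inv_mul_cancel₀ hn]
    · rw [mem_ofPred_eq, form_smul, form, h2]
      simp
  have hdir : Directed (· ⊇ ·) K := by
    rintro ⟨x, hx⟩ ⟨y, hy⟩
    rcases uIcc_subset_or hx hy with h | h
    · exact ⟨⟨y, hy⟩, fun v hv => ⟨hv.1, (S.outward_mul_form_mono v hx hy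
        (h right_mem_uIcc)).trans hv.2⟩, subset_rfl⟩
    · exact ⟨⟨x, hx⟩, subset_rfl, fun v hv => ⟨hv.1, (S.outward_mul_form_mono v hy hx
        (h right_mem_uIcc)).trans hv.2⟩⟩
  have : Nonempty (τ.side c b) := ⟨⟨c, mem_side S.mem b⟩⟩
  obtain ⟨v, hv⟩ := IsCompact.nonempty_iInter_of_directed_nonempty_isCompact_isClosed K hdir hne
    (fun x => (isCompact_sphere 0 1).inter_right
      (isClosed_le ((S.continuous_form x).const_mul _) continuous_const)) hclosed
  rw [mem_iInter] at hv
  refine ⟨v, ?_, fun x hx => (hv ⟨x, hx⟩).2⟩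
  rintro rfl
  simpa using (hv ⟨c, mem_side S.mem b⟩).1

lemma mem_l2Space_of_outward_form_nonpos (hz : z.im ≠ 0) {b : Bool} {v : ℂ × ℂ}
    (h : ∀ x ∈ τ.side c b, S.outward b * S.form v x ≤ 0) : v ∈ S.l2Space b := by
  rw [mem_l2Space, l2Side_iff (S.continuousOn_comb v)]
  have hz2 : 0 < z.im ^ 2 := by positivity
  refine integrableOn_side_of_bounded (M := -(S.outward b * S.form v c) / z.im ^ 2)
    (locallyIntegrableOn_r_mul_norm_sq (S.continuousOn_comb v))
    (τ.ae_r_mul_norm_sq_nonneg _) S.mem fun x hx => ?_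
  rw [le_div_iff₀ hz2]
  have := S.outward_mul_form_sub v hx
  have := h x hx
  linarith

/-- If a one-dimensional space of solutions lies in `L²` on one side, its form never becomes
positive in the outward direction. -/
lemma outward_form_nonpos (hz : z.im ≠ 0) {b : Bool} (hb : S.l2Space b ≠ ⊤) {v : ℂ × ℂ}
    (hv : v ∈ S.l2Space b) {x : ℝ} (hx : x ∈ τ.side c b) : S.outward b * S.form v x ≤ 0 := by
  obtain ⟨w, hw0, hw⟩ := S.exists_outward_form_nonpos b
  have hwm := S.mem_l2Space_of_outward_form_nonpos hz hw
  have hr : Module.finrank ℂ (S.l2Space b) ≤ 1 := by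
    have h := Submodule.finrank_lt hb
    simp only [Module.finrank_prod, Module.finrank_self] at h
    omega
  obtain ⟨t, ht⟩ := (finrank_le_one_iff.1 hr).imp fun _ h => h
  obtain ⟨s₁, hs₁⟩ := ht ⟨v, hv⟩
  obtain ⟨s₂, hs₂⟩ := ht ⟨w, hwm⟩
  have hs₂' : s₂ • (t : ℂ × ℂ) = w := congrArg Subtype.val hs₂
  have hs₁' : s₁ • (t : ℂ × ℂ) = v := congrArg Subtype.val hs₁
  have hs₂0 : s₂ ≠ 0 := by
    rintro rfl
    exact hw0 (by rw [← hs₂', zero_smul])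
  have hvw : v = (s₁ * s₂⁻¹) • w := by
    rw [← hs₁', ← hs₂', smul_smul, inv_mul_cancel_right₀ hs₂0]
  rw [hvw, form_smul, mul_left_comm]
  exact mul_nonpos_of_nonneg_of_nonpos (by positivity) (hw x hx)

theorem l2Space_inf_eq_bot (hz : z.im ≠ 0) (ha : S.l2Space false ≠ ⊤) (hb : S.l2Space true ≠ ⊤) :
    S.l2Space false ⊓ S.l2Space true = ⊥ := by
  rw [eq_bot_iff]
  rintro v ⟨hva, hvb⟩
  have h1 := S.outward_form_nonpos hz ha hva (mem_side S.mem false)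
  have h2 := fun x (hx : x ∈ τ.side c true) => S.outward_form_nonpos hz hb hvb hx
  have hz2 : 0 < z.im ^ 2 := by positivity
  have h3 : ∀ x ∈ τ.side c true, ∫ t in c..x, τ.r t * ‖S.comb v t‖ ^ 2 = 0 := fun x hx => by
    have h := S.outward_mul_form_sub v hx
    have h4 := h2 x hx
    simp only [outward] at h h1 h4
    have : |∫ t in c..x, τ.r t * ‖S.comb v t‖ ^ 2| ≤ 0 := by
      by_contra hcon
      push Not at hcon
      nlinarith [mul_pos hz2 hcon]
    exact abs_eq_zero.1 (le_antisymm this (abs_nonneg _))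
  obtain ⟨ε, hε, hball⟩ := Metric.isOpen_iff.1 τ.isOpen_I c S.mem
  have hd : c + ε / 2 ∈ τ.I := hball (by simp [abs_of_pos hε]; linarith)
  have hle : c ≤ c + ε / 2 := by linarith
  have hsub : Ioc c (c + ε / 2) ⊆ τ.I := by
    have := τ.ordConnected_I.uIcc_subset S.mem hd
    rw [uIcc_of_le hle] at this
    exact Ioc_subset_Icc_self.trans this
  have h4 := h3 (c + ε / 2) ⟨hd, mem_Ici.2 hle⟩
  rw [intervalIntegral.integral_of_le hle, setIntegral_eq_zero_iff_of_nonneg_ae] at h4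
  · rw [Submodule.mem_bot]
    refine S.eq_zero_of_ae_eq_zero (U := Ioo c (c + ε / 2)) isOpen_Ioo
      (Ioo_subset_Ioc_self.trans hsub) (nonempty_Ioo.2 (by linarith)) ?_
    filter_upwards [ae_mono (Measure.restrict_mono Ioo_subset_Ioc_self le_rfl) h4,
      ae_restrict_of_subset (Ioo_subset_Ioc_self.trans hsub) τ.ae_r_pos] with x hx hr
    simpa [hr.ne'] using hx
  · exact ae_restrict_of_subset hsub (τ.ae_r_mul_norm_sq_nonneg _)
  · have := (locallyIntegrableOn_r_mul_norm_sq (S.continuousOn_comb v)).intervalIntegrable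
      τ.ordConnected_I S.mem hd
    exact this.1

lemma finrank_l2Space_eq_one (hz : z.im ≠ 0) {b : Bool} (hb : S.l2Space b ≠ ⊤) :
    Module.finrank ℂ (S.l2Space b) = 1 := by
  have h := Submodule.finrank_lt hb
  simp only [Module.finrank_prod, Module.finrank_self] at h
  obtain ⟨w, hw0, hw⟩ := S.exists_outward_form_nonpos b
  have hwm := S.mem_l2Space_of_outward_form_nonpos hz hw
  have : 0 < Module.finrank ℂ (S.l2Space b) :=
    Module.finrank_pos_iff_exists_ne_zero.2 ⟨⟨w, hwm⟩, fun h => hw0 (congrArg Subtype.val h)⟩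
  omega

end FundamentalSystem

end SturmLiouville

namespace SturmLiouville

variable {τ : SturmLiouville}

/-! ### The adjoint of `T₀` -/

lemma inner_eq_integral (F G : τ.H) : inner ℂ F G = ∫ x, star (F x) * G x ∂τ.μ := by
  rw [L2.inner_def]
  refine integral_congr_ae (Eventually.of_forall fun x => ?_)
  simp [RCLike.inner_apply, mul_comm]

lemma inner_sub_inner_eq_integral {F G h k : τ.H} {f g u w : ℝ → ℂ} (hF : F =ᵐ[τ.μ] f)
    (hG : G =ᵐ[τ.μ] g) (hh : h =ᵐ[τ.μ] u) (hk : k =ᵐ[τ.μ] w) :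
    inner ℂ G h - inner ℂ F k =
      ∫ x in τ.I, (τ.r x : ℂ) * (star (g x) * u x - star (f x) * w x) := by
  have hi : ∀ A B : τ.H, Integrable (fun x => star (A x) * B x) τ.μ := fun A B => by
    refine (L2.integrable_inner (𝕜 := ℂ) A B).congr (Eventually.of_forall fun x => ?_)
    simp [RCLike.inner_apply, mul_comm]
  rw [inner_eq_integral, inner_eq_integral, ← integral_sub (hi G h) (hi F k), ← integral_μ]
  refine integral_congr_ae ?_
  filter_upwards [hF, hG, hh, hk] with x h1 h2 h3 h4
  rw [h1, h2, h3, h4]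

lemma expr_eq_zero_of_eqOn {f f₁ : ℝ → ℂ} {U : Set ℝ} (hU : IsOpen U) (h : EqOn f 0 U)
    (h₁ : EqOn f₁ 0 U) {x : ℝ} (hx : x ∈ U) : τ.expr f f₁ x = 0 := by
  rw [expr, (h₁.eventuallyEq_of_mem (hU.mem_nhds hx)).deriv_eq, h hx, h₁ hx]
  simp

lemma exists_Ioo_of_isCompact {K : Set ℝ} (hK : IsCompact K) (hKI : K ⊆ τ.I) :
    ∃ α ∈ τ.I, ∃ β ∈ τ.I, α < β ∧ K ⊆ Ioo α β := by
  obtain ⟨c, hc⟩ := τ.nonempty_I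
  have hK' : IsCompact (insert c K) := hK.insert c
  have hI' : insert c K ⊆ τ.I := insert_subset hc hKI
  obtain ⟨l, hl, hlmin⟩ := hK'.exists_isLeast (insert_nonempty c K)
  obtain ⟨u, hu, humax⟩ := hK'.exists_isGreatest (insert_nonempty c K)
  obtain ⟨ε, hε, hb⟩ := Metric.isOpen_iff.1 τ.isOpen_I l (hI' hl)
  obtain ⟨δ, hδ, hb'⟩ := Metric.isOpen_iff.1 τ.isOpen_I u (hI' hu)
  refine ⟨l - ε / 2, hb (by simp [abs_of_pos hε]; linarith), u + δ / 2,
    hb' (by simp [abs_of_pos hδ]; linarith), ?_, fun x hx => ?_⟩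
  · have := hlmin hu
    linarith
  · have h1 := hlmin (mem_insert_of_mem c hx)
    have h2 := humax (mem_insert_of_mem c hx)
    exact ⟨by linarith, by linarith⟩

/-- Lagrange's identity for a function of compact support. -/
lemma IsQuasiDeriv.integral_lagrange_eq_zero {f f₁ g g₁ : ℝ → ℂ} (hf : τ.IsQuasiDeriv f f₁)
    (hg : τ.IsQuasiDeriv g g₁) {K : Set ℝ} (hK : IsCompact K) (hKI : K ⊆ τ.I)
    (h0 : ∀ᵐ x ∂(volume.restrict τ.I), x ∉ K → f x = 0) :
    ∫ x in τ.I, (τ.r x : ℂ) * (star (τ.expr f f₁ x) * g x - star (f x) * τ.expr g g₁ x) = 0 := by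
  have hU : IsOpen (τ.I \ K) := τ.isOpen_I.sdiff hK.isClosed
  obtain ⟨hf0, hf10⟩ := hf.eqOn_zero hU sdiff_subset (by
    filter_upwards [ae_restrict_of_subset sdiff_subset h0, ae_restrict_mem hU.measurableSet]
      with x h1 h2 using h1 h2.2)
  obtain ⟨α, hα, β, hβ, hαβ, hKs⟩ := exists_Ioo_of_isCompact hK hKI
  have hαU : α ∈ τ.I \ K := ⟨hα, fun h => lt_irrefl _ (hKs h).1⟩
  have hβU : β ∈ τ.I \ K := ⟨hβ, fun h => lt_irrefl _ (hKs h).2⟩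
  have hsub : Ioc α β ⊆ τ.I := by
    have := τ.ordConnected_I.uIcc_subset hα hβ
    rw [uIcc_of_le hαβ.le] at this
    exact Ioc_subset_Icc_self.trans this
  rw [setIntegral_eq_of_subset_of_forall_sdiff_eq_zero τ.measurableSet_I hsub,
    ← intervalIntegral.integral_of_le hαβ.le]
  · have h := (hf.conj.lagrange hg hα hβ).2
    simp only [IsQuasiDeriv.expr_conj] at h
    rw [h]
    simp [wronskian, hf0 hαU, hf0 hβU, hf10 hαU, hf10 hβU]
  · intro x hx
    have hxU : x ∈ τ.I \ K := ⟨hx.1, fun h => hx.2 (Ioo_subset_Ioc_self (hKs h))⟩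
    rw [expr_eq_zero_of_eqOn hU hf0 hf10 hxU, hf0 hxU]
    simp

lemma mem_T0_graph {F : τ.H × τ.H} :
    F ∈ τ.T0.graph ↔ F ∈ τ.maxGraph ∧ F.1 ∈ τ.compactlySupported := by
  rw [← τ.Tmax_graph, T0, LinearPMap.mem_graph_iff, LinearPMap.mem_graph_iff]
  constructor
  · rintro ⟨y, h1, h2⟩
    have hy : (y : τ.H) ∈ τ.compactlySupported ⊓ τ.Tmax.domain := y.2
    refine ⟨⟨⟨y, hy.2⟩, h1, ?_⟩, h1 ▸ hy.1⟩
    rw [← h2]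
    exact (LinearPMap.domRestrict_apply rfl).symm
  · rintro ⟨⟨y, h1, h2⟩, h3⟩
    refine ⟨⟨y, ⟨h1 ▸ h3, y.2⟩⟩, h1, ?_⟩
    rw [← h2]
    exact LinearPMap.domRestrict_apply rfl

lemma maxGraph_le_adjoint (τ : SturmLiouville) : τ.maxGraph ≤ τ.T0.graph.adjoint := by
  rintro ⟨h, k⟩ ⟨g, g₁, hg, hgh, hgk⟩
  rw [Submodule.mem_adjoint_iff]
  intro F G hFG
  obtain ⟨⟨f, f₁, hf, hfF, hfG⟩, K, hK, hKI, hK0⟩ := mem_T0_graph.1 hFG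
  rw [inner_sub_inner_eq_integral hfF hfG hgh hgk]
  refine hf.integral_lagrange_eq_zero hg hK hKI (τ.ae_μ_iff.1 ?_)
  filter_upwards [hfF, hK0] with x h1 h2 h3
  rw [← h1, h2 h3]

/-- The fundamental system of complex conjugates. -/
def FundamentalSystem.conj {z : ℂ} {c : ℝ} (S : τ.FundamentalSystem z c) :
    τ.FundamentalSystem (star z) c where
  θ := fun x => star (S.θ x)
  θ₁ := fun x => star (S.θ₁ x)
  φ := fun x => star (S.φ x)
  φ₁ := fun x => star (S.φ₁ x)
  mem := S.mem
  sol_θ := S.sol_θ.conj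
  sol_φ := S.sol_φ.conj
  θ_c := by simp [S.θ_c]
  θ₁_c := by simp [S.θ₁_c]
  φ_c := by simp [S.φ_c]
  φ₁_c := by simp [S.φ₁_c]

lemma Ioc_subset_I {α β : ℝ} (hα : α ∈ τ.I) (hβ : β ∈ τ.I) : Ioc α β ⊆ τ.I := by
  rcases le_or_gt α β with h | h
  · have := τ.ordConnected_I.uIcc_subset hα hβ
    rw [uIcc_of_le h] at this
    exact Ioc_subset_Icc_self.trans this
  · simp [Ioc_eq_empty h.not_gt]

lemma memLp_indicator_Ioc {w : ℝ → ℂ} (hw : ContinuousOn w τ.I) {α β : ℝ} (hα : α ∈ τ.I)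
    (hβ : β ∈ τ.I) : MemLp ((Ioc α β).indicator w) 2 τ.μ := by
  rw [memLp_indicator_iff_restrict measurableSet_Ioc]
  refine (memLp_restrict_of_isCompact hw isCompact_uIcc
    (τ.ordConnected_I.uIcc_subset hα hβ)).mono_measure (Measure.restrict_mono ?_ le_rfl)
  exact Ioc_subset_Icc_self.trans Icc_subset_uIcc

/-- The solution of `τ f = g` with zero initial values for `g` supported in `(α, β]` and orthogonal
to the solutions of the homogeneous equation is supported in `[α, β]`. -/
lemma exists_T0_graph_of_orthogonal {α β c : ℝ} (hα : α ∈ τ.I) (hβ : β ∈ τ.I)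
    (S : τ.FundamentalSystem 0 c) {g : τ.H} (hg : ∀ᵐ x ∂τ.μ, x ∉ Ioc α β → g x = 0)
    (hθ : ∫ x, ((Ioc α β).indicator S.θ x) * g x ∂τ.μ = 0)
    (hφ : ∫ x, ((Ioc α β).indicator S.φ x) * g x ∂τ.μ = 0) :
    ∃ F : τ.H, (F, g) ∈ τ.T0.graph := by
  obtain ⟨f, f₁, hf, hfe, hfα, hf₁α⟩ := exists_initial_value 0
    (locallyIntegrableOn_r_mul (Lp.memLp g)) hα 0 0
  have hgI := τ.ae_μ_iff.1 hg
  have hJ := Ioc_subset_I hα hβ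
  have hint : ∀ {w : ℝ → ℂ}, ∫ x, ((Ioc α β).indicator w x) * g x ∂τ.μ = 0 →
      ∀ x ∈ τ.I, x ∉ Ioc α β → ∫ t in α..x, (τ.r t : ℂ) * (g t * w t) = 0 := by
    intro w hw x hx hxJ
    rcases le_or_gt x α with hxα | hxα
    · rw [intervalIntegral.integral_of_ge hxα, neg_eq_zero]
      refine integral_eq_zero_of_ae ?_
      filter_upwards [ae_restrict_of_subset (Ioc_subset_I hx hα) hgI,
        ae_restrict_mem measurableSet_Ioc] with t h1 h2
      rw [h1 fun h => absurd h.1 h2.2.not_gt]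
      simp
    · have hβx : β ≤ x := by
        by_contra hcon
        push Not at hcon
        exact hxJ ⟨hxα, hcon.le⟩
      rw [integral_μ] at hw
      rw [intervalIntegral.integral_of_le hxα.le, ← hw, ← integral_indicator measurableSet_Ioc,
        ← integral_indicator τ.measurableSet_I]
      refine integral_congr_ae ?_
      rw [ae_restrict_iff' τ.measurableSet_I] at hgI
      filter_upwards [hgI] with t ht
      by_cases htJ : t ∈ Ioc α β
      · rw [indicator_of_mem (hJ htJ), indicator_of_mem htJ,
          indicator_of_mem (show t ∈ Ioc α x from ⟨htJ.1, htJ.2.trans hβx⟩)]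
        ring
      · by_cases htI : t ∈ τ.I
        · simp [indicator, ht htI htJ]
        · rw [indicator_of_notMem htI,
            indicator_of_notMem fun h => htI (Ioc_subset_I hα hx h)]
  have hW : ∀ {w w₁ : ℝ → ℂ}, τ.IsSolPair 0 w w₁ →
      ∫ x, ((Ioc α β).indicator w x) * g x ∂τ.μ = 0 →
      ∀ x ∈ τ.I, x ∉ Ioc α β → wronskian f f₁ w w₁ x = 0 := by
    intro w w₁ hw hw0 x hx hxJ
    have h := hw.wronskian_sub hf hfe hα hx
    rw [hint hw0 x hx hxJ, sub_eq_zero] at h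
    rw [h, wronskian, hfα, hf₁α]
    simp
  have hf0 : ∀ x ∈ τ.I, x ∉ Ioc α β → f x = 0 := fun x hx hxJ => by
    rw [S.eq_wronskian f f₁ hx, hW S.sol_φ hφ x hx hxJ, hW S.sol_θ hθ x hx hxJ]
    simp
  have hL := memLp_indicator_Ioc hf.ac.continuousOn hα hβ
  have hae : ∀ᵐ x ∂τ.μ, (Ioc α β).indicator f x = f x := by
    refine τ.ae_μ_iff.2 ?_
    filter_upwards [ae_restrict_mem τ.measurableSet_I] with x hx
    by_cases hxJ : x ∈ Ioc α β
    · rw [indicator_of_mem hxJ]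
    · rw [indicator_of_notMem hxJ, hf0 x hx hxJ]
  refine ⟨hL.toLp _, mem_T0_graph.2 ⟨⟨f, f₁, hf, hL.coeFn_toLp.trans hae, ?_⟩,
    uIcc α β, isCompact_uIcc, τ.ordConnected_I.uIcc_subset hα hβ, ?_⟩⟩
  · refine τ.ae_μ_iff.2 ?_
    filter_upwards [hfe] with x hx
    simp [hx]
  · filter_upwards [hL.coeFn_toLp] with x hx hxK
    rw [hx, indicator_of_notMem fun h => hxK (Icc_subset_uIcc (Ioc_subset_Icc_self h))]

lemma exists_ae_eq_of_mem_adjoint {h k : τ.H} (hhk : (h, k) ∈ τ.T0.graph.adjoint)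
    {w w₁ : ℝ → ℂ} (hw : τ.IsQuasiDeriv w w₁)
    (hwk : ∀ᵐ x ∂(volume.restrict τ.I), τ.expr w w₁ x = k x) {c : ℝ}
    (S : τ.FundamentalSystem 0 c) {α β : ℝ} (hα : α ∈ τ.I) (hβ : β ∈ τ.I) :
    ∃ v : ℂ × ℂ, ∀ᵐ x ∂(volume.restrict (Ioc α β)), h x = w x + S.conj.comb v x := by
  have hJ := Ioc_subset_I hα hβ
  have hΘL := memLp_indicator_Ioc S.conj.sol_θ.qd.ac.continuousOn hα hβ
  have hΦL := memLp_indicator_Ioc S.conj.sol_φ.qd.ac.continuousOn hα hβ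
  have hwL := memLp_indicator_Ioc hw.ac.continuousOn hα hβ
  have hhL : MemLp ((Ioc α β).indicator h) 2 τ.μ := (Lp.memLp h).indicator measurableSet_Ioc
  set Θ : τ.H := hΘL.toLp _
  set Φ : τ.H := hΦL.toLp _
  set hJh : τ.H := hhL.toLp _
  set wJ : τ.H := hwL.toLp _
  have : FiniteDimensional ℂ (Submodule.span ℂ {Θ, Φ}) :=
    FiniteDimensional.span_of_finite ℂ (toFinite _)
  obtain ⟨y, hy, g, hg, hsum⟩ :=
    (Submodule.span ℂ {Θ, Φ}).exists_add_mem_mem_orthogonal (hJh - wJ)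
  obtain ⟨c₁, c₂, rfl⟩ := Submodule.mem_span_pair.1 hy
  refine ⟨(c₁, c₂), ?_⟩
  set η := w + S.conj.comb (c₁, c₂) with hη
  set η₁ := w₁ + S.conj.comb₁ (c₁, c₂)
  have hηq : τ.IsQuasiDeriv η η₁ := hw.add (S.conj.sol_comb _).qd
  have hηk : ∀ᵐ x ∂(volume.restrict τ.I), τ.expr η η₁ x = k x := by
    filter_upwards [hw.expr_add (S.conj.sol_comb (c₁, c₂)).qd, hwk,
      (S.conj.sol_comb (c₁, c₂)).eq] with x h1 h2 h3
    rw [h1, h2, h3]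
    simp
  have hηL := memLp_indicator_Ioc hηq.ac.continuousOn hα hβ
  set ηJ : τ.H := hηL.toLp _
  have hηJ : ηJ = wJ + (c₁ • Θ + c₂ • Φ) := by
    have e : (Ioc α β).indicator η = (Ioc α β).indicator w +
        (c₁ • (Ioc α β).indicator S.conj.θ + c₂ • (Ioc α β).indicator S.conj.φ) := by
      ext x
      by_cases hx : x ∈ Ioc α β <;> simp [hx, hη, FundamentalSystem.comb_apply]
    simp only [ηJ, wJ, Θ, Φ, ← MemLp.toLp_const_smul, ← MemLp.toLp_add]
    congr 1
  have hgeq : g = hJh - ηJ := by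
    rw [hηJ, ← sub_sub, hsum, add_sub_cancel_left]
  have hgae : ∀ᵐ x ∂τ.μ, g x = (Ioc α β).indicator (fun x => h x - η x) x := by
    rw [hgeq]
    filter_upwards [Lp.coeFn_sub hJh ηJ, hhL.coeFn_toLp, hηL.coeFn_toLp] with x h1 h2 h3
    rw [h1, Pi.sub_apply, h2, h3]
    by_cases hx : x ∈ Ioc α β <;> simp [hx]
  have hg0 : ∀ᵐ x ∂τ.μ, x ∉ Ioc α β → g x = 0 := by
    filter_upwards [hgae] with x hx hxJ
    rw [hx, indicator_of_notMem hxJ]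
  have horth : ∀ {s : ℝ → ℂ} (hs : MemLp ((Ioc α β).indicator fun x => star (s x)) 2 τ.μ),
      inner ℂ (hs.toLp _ : τ.H) g = 0 →
      ∫ x, ((Ioc α β).indicator s x) * g x ∂τ.μ = 0 := by
    intro s hs h0
    rw [inner_eq_integral] at h0
    rw [← h0]
    refine integral_congr_ae ?_
    filter_upwards [hs.coeFn_toLp] with x hx
    rw [hx]
    by_cases hxJ : x ∈ Ioc α β <;> simp [hxJ]
  obtain ⟨F, hF⟩ := exists_T0_graph_of_orthogonal hα hβ S hg0
    (horth hΘL ((Submodule.mem_orthogonal _ _).1 hg Θ (Submodule.subset_span (by simp))))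
    (horth hΦL ((Submodule.mem_orthogonal _ _).1 hg Φ (Submodule.subset_span (by simp))))
  have h1 := (Submodule.mem_adjoint_iff _ _).1 hhk F g hF
  obtain ⟨⟨f, f₁, hf, hfF, hfg⟩, K, hK, hKI, hK0⟩ := mem_T0_graph.1 hF
  have h2 : inner ℂ g ηJ - inner ℂ F k = 0 := by
    rw [inner_sub_inner_eq_integral hfF hfg hηL.coeFn_toLp (EventuallyEq.refl _ _),
      ← hf.integral_lagrange_eq_zero hηq hK hKI (τ.ae_μ_iff.1 (by
        filter_upwards [hfF, hK0] with x h1 h2 h3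
        rw [← h1, h2 h3]))]
    refine integral_congr_ae ?_
    filter_upwards [hηk, τ.ae_μ_iff.1 hg0, τ.ae_μ_iff.1 hfg] with x h3 h4 h5
    rw [h3]
    by_cases hxJ : x ∈ Ioc α β
    · rw [indicator_of_mem hxJ]
    · rw [← h5, h4 hxJ]
      simp
  have h3 : inner ℂ g h = inner ℂ g hJh := by
    rw [inner_eq_integral, inner_eq_integral]
    refine integral_congr_ae ?_
    filter_upwards [hg0, hhL.coeFn_toLp] with x h4 h5
    rw [h5]
    by_cases hxJ : x ∈ Ioc α β
    · rw [indicator_of_mem hxJ]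
    · rw [h4 hxJ]
      simp
  have h4 : inner ℂ g g = 0 := by
    nth_rewrite 2 [hgeq]
    rw [inner_sub_right, ← h3]
    simp only at h1
    linear_combination h1 - h2
  have h5 : g = 0 := inner_self_eq_zero.1 h4
  have h6 := ae_restrict_of_subset hJ (τ.ae_μ_iff.1 hgae)
  have h7 : ∀ᵐ x ∂τ.μ, g x = 0 := by
    rw [h5]
    exact Lp.coeFn_zero ℂ 2 τ.μ
  filter_upwards [h6, ae_restrict_of_subset hJ (τ.ae_μ_iff.1 h7),
    ae_restrict_mem measurableSet_Ioc] with x h8 h9 h10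
  rw [h9, indicator_of_mem h10] at h8
  exact (sub_eq_zero.1 h8.symm)

lemma adjoint_le_maxGraph (τ : SturmLiouville) : τ.T0.graph.adjoint ≤ τ.maxGraph := by
  rintro ⟨h, k⟩ hhk
  obtain ⟨c, hc⟩ := τ.nonempty_I
  obtain ⟨S⟩ := nonempty_fundamentalSystem (τ := τ) 0 hc
  obtain ⟨w, w₁, hw, hwk, -, -⟩ := exists_initial_value 0
    (locallyIntegrableOn_r_mul (Lp.memLp k)) hc 0 0
  replace hwk : ∀ᵐ x ∂(volume.restrict τ.I), τ.expr w w₁ x = k x := by simpa using hwk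
  obtain ⟨α₀, hα₀, β₀, hβ₀, hαβ₀, -⟩ := exists_Ioo_of_isCompact (isCompact_singleton (x := c))
    (singleton_subset_iff.2 hc)
  obtain ⟨v, hv⟩ := exists_ae_eq_of_mem_adjoint hhk hw hwk S hα₀ hβ₀
  have hae : ∀ᵐ x ∂(volume.restrict τ.I), h x = w x + S.conj.comb v x := by
    rw [ae_iff, Measure.restrict_apply₀' τ.measurableSet_I.nullMeasurableSet]
    refine measure_null_of_locally_null _ fun x hx => ?_
    obtain ⟨α, hα, β, hβ, -, hsub⟩ := exists_Ioo_of_isCompact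
      (K := {x, α₀, β₀}) (toFinite _).isCompact (by
        rintro y (rfl | rfl | rfl)
        exacts [hx.2, hα₀, hβ₀])
    have hxm : x ∈ Ioo α β := hsub (by simp)
    have hαm : α₀ ∈ Ioo α β := hsub (by simp)
    have hβm : β₀ ∈ Ioo α β := hsub (by simp)
    obtain ⟨v', hv'⟩ := exists_ae_eq_of_mem_adjoint hhk hw hwk S hα hβ
    have hs₁ : Ioo α₀ β₀ ⊆ Ioc α₀ β₀ := Ioo_subset_Ioc_self
    have hs₂ : Ioo α₀ β₀ ⊆ Ioc α β := fun t ht =>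
      ⟨hαm.1.trans ht.1, (ht.2.trans hβm.2).le⟩
    have hvv : v' - v = 0 := by
      refine S.conj.eq_zero_of_ae_eq_zero isOpen_Ioo (hs₁.trans (Ioc_subset_I hα₀ hβ₀))
        (nonempty_Ioo.2 hαβ₀) ?_
      filter_upwards [ae_mono (Measure.restrict_mono hs₁ le_rfl) hv,
        ae_mono (Measure.restrict_mono hs₂ le_rfl) hv'] with t h1 h2
      rw [FundamentalSystem.comb_apply] at h1 h2 ⊢
      simp only [Prod.fst_sub, Prod.snd_sub]
      linear_combination h1 - h2
    rw [sub_eq_zero] at hvv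
    rw [hvv, ae_iff, Measure.restrict_apply₀' measurableSet_Ioc.nullMeasurableSet] at hv'
    refine ⟨_ ∩ Ioo α β, inter_mem_nhdsWithin _ (isOpen_Ioo.mem_nhds hxm),
      measure_mono_null ?_ hv'⟩
    exact fun y hy => ⟨hy.1.1, Ioo_subset_Ioc_self hy.2⟩
  refine ⟨w + S.conj.comb v, w₁ + S.conj.comb₁ v, hw.add (S.conj.sol_comb v).qd,
    τ.ae_μ_iff.2 hae, τ.ae_μ_iff.2 ?_⟩
  filter_upwards [hw.expr_add (S.conj.sol_comb v).qd, hwk, (S.conj.sol_comb v).eq]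
    with x h1 h2 h3
  rw [h1, h2, h3]
  simp

theorem T0_graph_adjoint (τ : SturmLiouville) : τ.T0.graph.adjoint = τ.maxGraph :=
  le_antisymm τ.adjoint_le_maxGraph τ.maxGraph_le_adjoint

end SturmLiouville

/-! ### Adjoints, defect spaces and self-adjointness -/

section Adjoint

variable {E : Type*} [NormedAddCommGroup E] [InnerProductSpace ℂ E]

theorem Submodule.adjoint_topologicalClosure (g : Submodule ℂ (E × E)) :
    g.topologicalClosure.adjoint = g.adjoint := by
  ext x
  rw [Submodule.mem_adjoint_iff, Submodule.mem_adjoint_iff]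
  refine ⟨fun h a b hab => h a b (g.le_topologicalClosure hab), fun h a b hab => ?_⟩
  have hc : IsClosed {y : E × E | inner ℂ y.2 x.1 - inner ℂ y.1 x.2 = 0} :=
    isClosed_eq (by fun_prop) continuous_const
  exact closure_minimal (s := (g : Set (E × E))) (fun y hy => h y.1 y.2 hy) hc hab

theorem mem_orthogonal_range_sub_smul {T : E →ₗ.[ℂ] E} {z : ℂ} {h : E} :
    h ∈ (LinearMap.range (T.toFun - z • T.domain.subtype))ᗮ ↔
      (h, star z • h) ∈ T.graph.adjoint := by
  rw [Submodule.mem_orthogonal, Submodule.mem_adjoint_iff]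
  constructor
  · intro H a b hab
    obtain ⟨y, rfl, rfl⟩ := T.mem_graph_iff.1 hab
    have := H _ ⟨y, rfl⟩
    simpa [inner_sub_left, inner_smul_left, inner_smul_right] using this
  · rintro H _ ⟨y, rfl⟩
    have := H _ _ (T.mem_graph y)
    simpa [inner_sub_left, inner_smul_left, inner_smul_right] using this

theorem LinearPMap.IsFormalAdjoint.norm_le_norm_sub_smul_I {T : E →ₗ.[ℂ] E}
    (hT : T.IsFormalAdjoint T) {x : E × E} (hx : x ∈ T.graph) :
    ‖x‖ ≤ ‖x.2 - Complex.I • x.1‖ := by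
  obtain ⟨y, h1, h2⟩ := T.mem_graph_iff.1 hx
  have hre : RCLike.re (inner ℂ x.2 (Complex.I • x.1)) = 0 := by
    have h := hT y y
    rw [h1, h2] at h
    have h' := inner_conj_symm (𝕜 := ℂ) x.2 x.1
    rw [← h] at h'
    have him : (inner ℂ x.2 x.1 : ℂ).im = 0 := Complex.conj_eq_iff_im.1 h'
    simp [him]
  have hsq : ‖x.2 - Complex.I • x.1‖ ^ 2 = ‖x.2‖ ^ 2 + ‖x.1‖ ^ 2 := by
    rw [@norm_sub_sq ℂ, hre, norm_smul]
    simp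
  rw [Prod.norm_def]
  refine max_le ?_ ?_ <;> refine le_of_sq_le_sq ?_ (norm_nonneg _) <;> rw [hsq] <;>
    nlinarith [sq_nonneg ‖x.1‖, sq_nonneg ‖x.2‖]

/-- A closed symmetric operator with vanishing defect spaces contains its adjoint. -/
theorem LinearPMap.IsFormalAdjoint.adjoint_graph_le [CompleteSpace E] {T : E →ₗ.[ℂ] E}
    (hT : T.IsFormalAdjoint T) (hc : T.IsClosed)
    (h₁ : (LinearMap.range (T.toFun - Complex.I • T.domain.subtype))ᗮ = ⊥)
    (h₂ : (LinearMap.range (T.toFun - (-Complex.I) • T.domain.subtype))ᗮ = ⊥) :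
    T.graph.adjoint ≤ T.graph := by
  have : CompleteSpace T.graph := hc.completeSpace_coe
  let L : T.graph →L[ℂ] E :=
    (ContinuousLinearMap.snd ℂ E E - Complex.I • ContinuousLinearMap.fst ℂ E E).comp
      T.graph.subtypeL
  have hL : AntilipschitzWith 1 L := by
    refine AddMonoidHomClass.antilipschitz_of_bound L fun x => ?_
    simpa [L] using hT.norm_le_norm_sub_smul_I x.2
  have hrange : LinearMap.range (T.toFun - Complex.I • T.domain.subtype) =
      LinearMap.range (L : T.graph →ₗ[ℂ] E) := by
    ext y
    constructor
    · rintro ⟨x, rfl⟩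
      exact ⟨⟨_, T.mem_graph x⟩, rfl⟩
    · rintro ⟨⟨x, hx⟩, rfl⟩
      obtain ⟨w, h1, h2⟩ := T.mem_graph_iff.1 hx
      refine ⟨w, ?_⟩
      simp only [LinearMap.sub_apply, LinearMap.smul_apply, Submodule.subtype_apply, h1]
      change T w - _ = x.2 - Complex.I • x.1
      rw [h2]
  have hclosed : _root_.IsClosed (LinearMap.range (L : T.graph →ₗ[ℂ] E) : Set E) :=
    hL.isClosed_range L.uniformContinuous
  have htop : LinearMap.range (L : T.graph →ₗ[ℂ] E) = ⊤ := by
    have : CompleteSpace (LinearMap.range (L : T.graph →ₗ[ℂ] E)) := hclosed.completeSpace_coe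
    rw [hrange] at h₁
    exact Submodule.orthogonal_eq_bot_iff.1 h₁
  rintro ⟨g, k⟩ hgk
  obtain ⟨⟨x, hx⟩, hxe⟩ : k - Complex.I • g ∈ LinearMap.range (L : T.graph →ₗ[ℂ] E) :=
    htop ▸ Submodule.mem_top
  replace hxe : x.2 - Complex.I • x.1 = k - Complex.I • g := hxe
  have hxadj : x ∈ T.graph.adjoint := by
    rw [Submodule.mem_adjoint_iff]
    intro a b hab
    obtain ⟨w, h1, h2⟩ := T.mem_graph_iff.1 hx
    obtain ⟨y, rfl, rfl⟩ := T.mem_graph_iff.1 hab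
    have := hT y w
    rw [h1, h2] at this
    rw [this, sub_self]
  have hd := T.graph.adjoint.sub_mem hgk hxadj
  have hd2 : (g, k) - x = (g - x.1, star (-Complex.I) • (g - x.1)) := by
    refine Prod.ext rfl ?_
    simp only [Prod.snd_sub, star_neg, Complex.star_def, Complex.conj_I, neg_neg, smul_sub]
    rw [sub_eq_sub_iff_add_eq_add] at hxe ⊢
    rw [← hxe]
    abel
  rw [hd2, ← mem_orthogonal_range_sub_smul, h₂, Submodule.mem_bot, sub_eq_zero] at hd
  have hk : k = x.2 := by
    rw [hd] at hxe
    exact (sub_left_inj.1 hxe).symm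
  rw [hd, hk]
  exact hx

end Adjoint

namespace SturmLiouville

variable {τ : SturmLiouville}

theorem dense_T0_domain (τ : SturmLiouville) : Dense (τ.T0.domain : Set τ.H) := by
  rw [Submodule.dense_iff_topologicalClosure_eq_top, Submodule.topologicalClosure_eq_top_iff,
    eq_bot_iff]
  intro k hk
  have h : ((0 : τ.H), k) ∈ τ.T0.graph.adjoint := by
    rw [Submodule.mem_adjoint_iff]
    intro a b hab
    obtain ⟨y, rfl, rfl⟩ := τ.T0.mem_graph_iff.1 hab
    simp [(Submodule.mem_orthogonal _ _).1 hk y y.2]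
  rw [T0_graph_adjoint] at h
  exact τ.maxGraph_fst_eq_zero _ h rfl

theorem T0_adjoint (τ : SturmLiouville) : τ.T0.adjoint = τ.Tmax := by
  refine LinearPMap.eq_of_eq_graph ?_
  rw [LinearPMap.adjoint_graph_eq_graph_adjoint τ.dense_T0_domain, T0_graph_adjoint, Tmax_graph]

theorem isClosed_Tmax (τ : SturmLiouville) : τ.Tmax.IsClosed :=
  τ.T0_adjoint ▸ LinearPMap.adjoint_isClosed τ.dense_T0_domain

theorem isClosable_T0 (τ : SturmLiouville) : τ.T0.IsClosable :=
  τ.isClosed_Tmax.isClosable.leIsClosable LinearPMap.domRestrict_le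

theorem Tmin_graph_adjoint (τ : SturmLiouville) : τ.Tmin.graph.adjoint = τ.maxGraph := by
  rw [Tmin, ← τ.isClosable_T0.graph_closure_eq_closure_graph,
    Submodule.adjoint_topologicalClosure, T0_graph_adjoint]

theorem dense_Tmin_domain (τ : SturmLiouville) : Dense (τ.Tmin.domain : Set τ.H) :=
  τ.dense_T0_domain.mono τ.T0.le_closure.1

theorem Tmin_adjoint (τ : SturmLiouville) : τ.Tmin.adjoint = τ.Tmax := by
  refine LinearPMap.eq_of_eq_graph ?_
  rw [LinearPMap.adjoint_graph_eq_graph_adjoint τ.dense_Tmin_domain, Tmin_graph_adjoint,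
    Tmax_graph]

theorem Tmin_le_Tmax (τ : SturmLiouville) : τ.Tmin ≤ τ.Tmax := by
  refine LinearPMap.le_of_le_graph ?_
  rw [Tmin, ← τ.isClosable_T0.graph_closure_eq_closure_graph]
  exact Submodule.topologicalClosure_minimal _
    (LinearPMap.le_graph_of_le LinearPMap.domRestrict_le) τ.isClosed_Tmax

theorem Tmin_isFormalAdjoint (τ : SturmLiouville) : τ.Tmin.IsFormalAdjoint τ.Tmin := by
  intro x y
  have h := LinearPMap.adjoint_isFormalAdjoint τ.dense_Tmin_domain
  rw [Tmin_adjoint] at h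
  rw [τ.Tmin_le_Tmax.2 (x := x) (y := ⟨x, τ.Tmin_le_Tmax.1 x.2⟩) rfl]
  exact h ⟨x, τ.Tmin_le_Tmax.1 x.2⟩ y

/-! ### The deficiency indices -/

namespace FundamentalSystem

variable {z : ℂ} {c : ℝ} (S : τ.FundamentalSystem z c)

lemma memLp_comb (v : ↥(S.l2Space false ⊓ S.l2Space true)) : MemLp (S.comb v) 2 τ.μ :=
  (memLp_iff_l2Side (S.continuousOn_comb v) c).2 v.2

/-- The solutions in `L²((a, b); r(x) dx)` as elements of the Hilbert space. -/
noncomputable def toH : ↥(S.l2Space false ⊓ S.l2Space true) →ₗ[ℂ] τ.H where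
  toFun v := (S.memLp_comb v).toLp _
  map_add' v w := by
    rw [← MemLp.toLp_add]
    congr 1
    ext x
    simp [comb_apply]
    ring
  map_smul' t v := by
    rw [RingHom.id_apply, ← MemLp.toLp_const_smul]
    congr 1
    ext x
    simp [comb_apply]
    ring

lemma coeFn_toH (v : ↥(S.l2Space false ⊓ S.l2Space true)) : S.toH v =ᵐ[τ.μ] S.comb v :=
  (S.memLp_comb v).coeFn_toLp

lemma toH_injective : Function.Injective S.toH := by
  refine (injective_iff_map_eq_zero _).2 fun v hv => ?_
  have h := S.coeFn_toH v
  rw [hv] at h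
  refine Subtype.ext (S.eq_zero_of_ae_eq_zero τ.isOpen_I subset_rfl τ.nonempty_I
    (τ.ae_μ_iff.1 ?_))
  filter_upwards [h, Lp.coeFn_zero ℂ 2 τ.μ] with x h1 h2
  rw [← h1, h2, Pi.zero_apply]

lemma mem_range_toH {h : τ.H} : h ∈ LinearMap.range S.toH ↔ (h, z • h) ∈ τ.maxGraph := by
  constructor
  · rintro ⟨v, rfl⟩
    refine ⟨S.comb v, S.comb₁ v, (S.sol_comb v).qd, S.coeFn_toH v, ?_⟩
    filter_upwards [Lp.coeFn_smul z (S.toH v), S.coeFn_toH v, τ.ae_μ_iff.2 (S.sol_comb v).eq]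
      with x h1 h2 h3
    rw [h1, h3, Pi.smul_apply, h2, smul_eq_mul]
  · rintro ⟨f, f₁, hf, h1, h2⟩
    have hsol : τ.IsSolPair z f f₁ := by
      refine ⟨hf, τ.ae_μ_iff.1 ?_⟩
      filter_upwards [h1, h2, Lp.coeFn_smul z h] with x h1 h2 h3
      rw [← h2, ← h1, h3, Pi.smul_apply, smul_eq_mul]
    have hae : h =ᵐ[τ.μ] S.comb (f c, f₁ c) := by
      filter_upwards [h1, τ.ae_μ_iff.2 (ae_restrict_mem τ.measurableSet_I)] with x h3 h4
      rw [h3, S.eq_comb hsol h4]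
    have hL : MemLp (S.comb (f c, f₁ c)) 2 τ.μ := (memLp_congr_ae hae).1 (Lp.memLp h)
    refine ⟨⟨(f c, f₁ c), (memLp_iff_l2Side (S.continuousOn_comb _) c).1 hL⟩, ?_⟩
    exact Lp.ext ((S.coeFn_toH _).trans hae.symm)

end FundamentalSystem

lemma defectNumber_Tmin (z : ℂ) {c : ℝ} (S : τ.FundamentalSystem (star z) c) :
    defectNumber τ.Tmin z = Module.finrank ℂ ↥(S.l2Space false ⊓ S.l2Space true) := by
  have h : (LinearMap.range (τ.Tmin.toFun - z • τ.Tmin.domain.subtype))ᗮ =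
      LinearMap.range S.toH := by
    ext h
    rw [mem_orthogonal_range_sub_smul, Tmin_graph_adjoint, S.mem_range_toH]
  rw [defectNumber, h, Module.finrank_eq_rank,
    (LinearEquiv.ofInjective S.toH S.toH_injective).rank_eq]

theorem defectNumber_Tmin_eq_zero {z : ℂ} (hz : z.im ≠ 0) (ha : ¬ τ.LimitCircleA)
    (hb : ¬ τ.LimitCircleB) : defectNumber τ.Tmin z = 0 := by
  obtain ⟨c, hc⟩ := τ.nonempty_I
  obtain ⟨S⟩ := nonempty_fundamentalSystem (star z) hc
  rw [S.limitCircleA_iff] at ha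
  rw [S.limitCircleB_iff] at hb
  rw [defectNumber_Tmin z S, S.l2Space_inf_eq_bot (by simpa using hz) ha hb]
  simp

theorem defectNumber_Tmin_eq_one {z : ℂ} (hz : z.im ≠ 0)
    (h : Xor τ.LimitCircleA τ.LimitCircleB) : defectNumber τ.Tmin z = 1 := by
  obtain ⟨c, hc⟩ := τ.nonempty_I
  obtain ⟨S⟩ := nonempty_fundamentalSystem (star z) hc
  have hz' : (star z).im ≠ 0 := by simpa using hz
  rw [defectNumber_Tmin z S]
  rw [S.limitCircleA_iff, S.limitCircleB_iff] at h
  rcases h with ⟨h1, h2⟩ | ⟨h1, h2⟩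
  · rw [h1, top_inf_eq, S.finrank_l2Space_eq_one hz' h2, Nat.cast_one]
  · rw [h1, inf_top_eq, S.finrank_l2Space_eq_one hz' h2, Nat.cast_one]

theorem defectNumber_Tmin_eq_two (z : ℂ) (ha : τ.LimitCircleA) (hb : τ.LimitCircleB) :
    defectNumber τ.Tmin z = 2 := by
  obtain ⟨c, hc⟩ := τ.nonempty_I
  obtain ⟨S⟩ := nonempty_fundamentalSystem (star z) hc
  rw [S.limitCircleA_iff] at ha
  rw [S.limitCircleB_iff] at hb
  rw [defectNumber_Tmin z S, ha, hb, inf_idem, finrank_top]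
  norm_num

theorem Tmin_eq_Tmax (ha : ¬ τ.LimitCircleA) (hb : ¬ τ.LimitCircleB) : τ.Tmin = τ.Tmax := by
  have h : ∀ z : ℂ, z.im ≠ 0 →
      (LinearMap.range (τ.Tmin.toFun - z • τ.Tmin.domain.subtype))ᗮ = ⊥ := fun z hz =>
    Submodule.rank_eq_zero.1 (defectNumber_Tmin_eq_zero hz ha hb)
  refine le_antisymm τ.Tmin_le_Tmax (LinearPMap.le_of_le_graph ?_)
  rw [Tmax_graph, ← Tmin_graph_adjoint]
  exact τ.Tmin_isFormalAdjoint.adjoint_graph_le τ.isClosable_T0.closure_isClosed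
    (h _ (by simp)) (h _ (by simp))

end SturmLiouville

theorem mainTheorem1 (τ : SturmLiouville) :
    -- the minimal operator is well defined, densely defined and symmetric
    (Dense (τ.T0.domain : Set τ.H) ∧ τ.T0.IsClosable ∧ τ.Tmin.IsFormalAdjoint τ.Tmin) ∧
    -- Weyl's alternative at each endpoint
    (Xor τ.LimitCircleA τ.LimitPointA ∧ Xor τ.LimitCircleB τ.LimitPointB) ∧
    -- the deficiency indices of the minimal operator
    (¬ τ.LimitCircleA ∧ ¬ τ.LimitCircleB →
      defectNumber τ.Tmin Complex.I = 0 ∧ defectNumber τ.Tmin (-Complex.I) = 0) ∧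
    (Xor τ.LimitCircleA τ.LimitCircleB →
      defectNumber τ.Tmin Complex.I = 1 ∧ defectNumber τ.Tmin (-Complex.I) = 1) ∧
    (τ.LimitCircleA ∧ τ.LimitCircleB →
      defectNumber τ.Tmin Complex.I = 2 ∧ defectNumber τ.Tmin (-Complex.I) = 2) ∧
    -- the case of two limit-point endpoints
    (τ.LimitPointA ∧ τ.LimitPointB → τ.Tmin = τ.Tmax ∧ IsSelfAdjoint τ.Tmin) := by
  have h₁ : Complex.I.im ≠ 0 := by simp
  have h₂ : (-Complex.I).im ≠ 0 := by simp
  rw [τ.limitPointA_iff, τ.limitPointB_iff]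
  refine ⟨⟨τ.dense_T0_domain, τ.isClosable_T0, τ.Tmin_isFormalAdjoint⟩,
    ⟨xor_not_right.2 Iff.rfl, xor_not_right.2 Iff.rfl⟩,
    fun ⟨ha, hb⟩ => ⟨SturmLiouville.defectNumber_Tmin_eq_zero h₁ ha hb,
      SturmLiouville.defectNumber_Tmin_eq_zero h₂ ha hb⟩,
    fun h => ⟨SturmLiouville.defectNumber_Tmin_eq_one h₁ h,
      SturmLiouville.defectNumber_Tmin_eq_one h₂ h⟩,
    fun ⟨ha, hb⟩ => ⟨SturmLiouville.defectNumber_Tmin_eq_two _ ha hb,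
      SturmLiouville.defectNumber_Tmin_eq_two _ ha hb⟩,
    fun ⟨ha, hb⟩ => ?_⟩
  have h := SturmLiouville.Tmin_eq_Tmax ha hb
  exact ⟨h, LinearPMap.isSelfAdjoint_def.2 (τ.Tmin_adjoint.trans h.symm)⟩
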